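/- Let $0<\alpha\le 1$ and $0<p\le 1$. On a probability space let $(Q_n)_{n\ge 0}$ be a Markov chain on $\{0,1,2,\dots\}$ with $Q_0=0$ almost surely and transition probabilities $$q_{k,k+1}=p\ \ (k\ge 0),\qquad q_{k,k-1}=1-p\ \ (k\ge 1),\qquad q_{0,0}=1-p,$$ all others being zero. Let $T_1,T_2,\dots$ be i.i.d. random variables, independent of $(Q_n)$, with the Mittag-Leffler distribution of index $\alpha$, i.e. $$\mathbb P\{T_i\le x\}=1-E_{\alpha,1}(-x^\alpha)\quad (x\ge 0),\qquad E_{\alpha,\beta}(x)=\sum_{\ell\ge 0}\frac{x^\ell}{\Gamma(\beta+\alpha\ell)}.$$ Let $N^{(\alpha)}(t)=\max\{k: T_1+\dots+T_k\le t<T_1+\dots+T_{k+1}\}$, let $L(t)=Q_{N^{(\alpha)}(t)}$ be the queue length, $p_{0,0}(t)=\mathbb P\{L(t)=0\}$, and $M(z,t)=\mathbb E\,e^{zL(t)}$ for $z\in\mathbb R$. Then for every $z\in\mathbb R$ the following hold. 1. $M(z,t)<\infty$ for all $t\ge 0$. 2. For every $t>0$ the Caputo derivative of order $\alpha$ of $M(z,\cdot)$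 at $t$ exists and $$\frac{d^\alpha}{dt^\alpha}M(z,t)=(1-p)(1-e^{-z})\,p_{0,0}(t)+\big(pe^z-1+(1-p)e^{-z}\big)M(z,t).$$ Here, for $\alpha<1$, $\frac{d^\alpha}{dt^\alpha}f(t)=\frac1{\Gamma(1-\alpha)}\int_0^t(t-u)^{-\alpha}f'(u)\,du$, where existence means that $f$ is continuous on $[0,t]$ and differentiable on $(0,t)$ and that the integral converges absolutely; for $\alpha=1$ it is the ordinary derivative (again with $f$ continuous on $[0,t]$). 3. For $s>0$ put $$r_{1}(s)=\frac{1+s^\alpha+\sqrt{(1+s^\alpha)^2-4p(1-p)}}{2p},\qquad r_{2}(s)=\frac{1+s^\alpha-\sqrt{(1+s^\alpha)^2-4p(1-p)}}{2p}.$$ The Laplace integral $\int_0^\infty e^{-st}M(z,t)\,dt$ converges if and only if $e^z<r_1(s)$, and in that case $$\int_0^\infty e^{-st}M(z,t)\,dt=\frac{-s^{\alpha-1}}{p\,(e^z-r_1(s))\,(1-r_2(s))}.$$ -/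

import Mathlib

open MeasureTheory ProbabilityTheory

noncomputable section

namespace FractionalQueue

/-- The two-parameter Mittag-Leffler function `E_{α,β}(x) = ∑ xˡ / Γ(β + α l)`. -/
def mittagLeffler (α β x : ℝ) : ℝ :=
  ∑' l : ℕ, x ^ l / Real.Gamma (β + α * l)

/-- `X` has the Mittag-Leffler distribution of index `α` (and scale `1`): its cumulative
distribution function on `[0, ∞)` is `1 - E_{α,1}(-x^α)`.  In particular `X > 0` a.s. -/
def IsMittagLefflerDistributed {Ω : Type*} [MeasurableSpace Ω] (α : ℝ) (X : Ω → ℝ)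
    (μ : Measure Ω) : Prop :=
  ∀ x : ℝ, 0 ≤ x → μ.real {ω | X ω ≤ x} = 1 - mittagLeffler α 1 (-(x ^ α))

/-- Transition probabilities of the discrete-time queue: an arrival (`i → i + 1`) with probability
`p`, a service completion (`i → i - 1`) with probability `1 - p`.  The subtraction is truncated:
a service completion in an empty queue leaves it empty. -/
def queueTransition (p : ℝ) (i j : ℕ) : ℝ :=
  if j = i + 1 then p else if j = i - 1 then 1 - p else 0

/-- `Q` is a Markov chain on `ℕ`, started at `0`, with transition probabilities
`queueTransition p`.  The Markov property
`P(Q_{n+1} = x_{n+1} | Q_0 = x_0, …, Q_n = x_n) = q(x_n, x_{n+1})` is written without division. -/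
structure IsDiscreteQueue {Ω : Type*} [MeasurableSpace Ω] (p : ℝ) (Q : ℕ → Ω → ℕ)
    (μ : Measure Ω) : Prop where
  measurable : ∀ n, Measurable (Q n)
  initial : ∀ᵐ ω ∂μ, Q 0 ω = 0
  markov : ∀ (n : ℕ) (x : ℕ → ℕ),
    μ.real {ω | ∀ k ≤ n + 1, Q k ω = x k} =
      μ.real {ω | ∀ k ≤ n, Q k ω = x k} * queueTransition p (x n) (x (n + 1))

/-- `T 0, T 1, …` are i.i.d. inter-event times with the Mittag-Leffler distribution. -/
structure IsMittagLefflerRenewal {Ω : Type*} [MeasurableSpace Ω] (α : ℝ) (T : ℕ → Ω → ℝ)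
    (μ : Measure Ω) : Prop where
  measurable : ∀ n, Measurable (T n)
  indep : iIndepFun T μ
  law : ∀ n, IsMittagLefflerDistributed α (T n) μ

/-- The counting process of the inter-event times `T`:
`N(t) = max {k : T_0 + ⋯ + T_{k-1} ≤ t < T_0 + ⋯ + T_k}`. -/
def countingProcess {Ω : Type*} (T : ℕ → Ω → ℝ) (t : ℝ) (ω : Ω) : ℕ :=
  sSup {k : ℕ | ∑ i ∈ Finset.range k, T i ω ≤ t ∧ t < ∑ i ∈ Finset.range (k + 1), T i ω}

/-- The queue length `L(t) = Q_{N(t)}`. -/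
def queueLength {Ω : Type*} (Q : ℕ → Ω → ℕ) (T : ℕ → Ω → ℝ) (t : ℝ) (ω : Ω) : ℕ :=
  Q (countingProcess T t ω) ω

/-- The moment generating function `M(z, t) = E exp(z L(t))`. -/
def queueMgf {Ω : Type*} [MeasurableSpace Ω] (μ : Measure Ω) (Q : ℕ → Ω → ℕ) (T : ℕ → Ω → ℝ)
    (z t : ℝ) : ℝ :=
  mgf (fun ω => (queueLength Q T t ω : ℝ)) μ z

/-- The probability `p_{0,0}(t)` of an empty queue at time `t`. -/
def emptyProb {Ω : Type*} [MeasurableSpace Ω] (μ : Measure Ω) (Q : ℕ → Ω → ℕ) (T : ℕ → Ω → ℝ)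
    (t : ℝ) : ℝ :=
  μ.real {ω | queueLength Q T t ω = 0}

/-- The Caputo derivative of order `α ∈ (0, 1]` of `f` at `t > 0` exists and equals `c`:
`c = (1 / Γ(1 - α)) ∫₀ᵗ (t - u)^{-α} f'(u) du` if `α < 1`, where `f` is continuous on `[0, t]`,
differentiable on `(0, t)`, and the integral converges absolutely; the derivative of order `1` is
the ordinary derivative. -/
def HasCaputoDerivAt (α : ℝ) (f : ℝ → ℝ) (c t : ℝ) : Prop :=
  if α = 1 then ContinuousOn f (Set.Icc 0 t) ∧ HasDerivAt f c t
  else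
    ContinuousOn f (Set.Icc 0 t) ∧
    (∀ u ∈ Set.Ioo 0 t, DifferentiableAt ℝ f u) ∧
    IntegrableOn (fun u => (t - u) ^ (-α) * deriv f u) (Set.Ioo 0 t) ∧
    1 / Real.Gamma (1 - α) * ∫ u in Set.Ioo 0 t, (t - u) ^ (-α) * deriv f u = c

/-- The Laplace transform `∫₀^∞ exp(-s t) f(t) dt`. -/
def laplaceTransform (f : ℝ → ℝ) (s : ℝ) : ℝ :=
  ∫ t in Set.Ioi (0 : ℝ), Real.exp (-s * t) * f t

/-- The Laplace integral of `f` at `s` converges absolutely. -/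
def LaplaceConvergent (f : ℝ → ℝ) (s : ℝ) : Prop :=
  IntegrableOn (fun t => Real.exp (-s * t) * f t) (Set.Ioi (0 : ℝ))

/-- The larger root `r₁(s)`. -/
def r₁ (α p s : ℝ) : ℝ :=
  (1 + s ^ α + Real.sqrt ((1 + s ^ α) ^ 2 - 4 * p * (1 - p))) / (2 * p)

/-- The smaller root `r₂(s)`. -/
def r₂ (α p s : ℝ) : ℝ :=
  (1 + s ^ α - Real.sqrt ((1 + s ^ α) ^ 2 - 4 * p * (1 - p))) / (2 * p)

end FractionalQueue

end

/-!
Write `S n` for the renewal times, `N` for the counting process and `I^α` for the Riemann-Liouville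
integral. The Mittag-Leffler distribution is exactly what makes `P(S (n + 1) ≤ t)` equal to
`I^α (P(N = n))`; summation by parts against a sequence `b` turns this into
`E b(N(t)) = b 0 + I^α (E (Δb)(N))(t)`, whose differentiated form says that `E (Δb)(N(t))` is the
Caputo derivative of `E b(N)`. For `b n = E y ^ Q n`, with `y = exp z`, the Markov property of the
queue evaluates `Δb`: it is `(p y - 1 + (1 - p) / y) b` plus a boundary term coming from the
reflection at `0`.

On the Laplace side `P(N = n)` has transform `s ^ (α - 1) / (1 + s ^ α) ^ (n + 1)`, so the transform
of `M(z, ·)` is the generating function of the occupation measure of the chain, discounted by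
`x = (1 + s ^ α)⁻¹` per step. The discounted occupation measure solves the second-order recursion
with characteristic roots `1 / r₁` and `1 / r₂`, where `0 ≤ r₂ < 1 < r₁`; being bounded, it cannot
contain the mode `r₂ ^ (-k)` and is geometric with ratio `1 / r₁`. The transform is therefore a
geometric series in `exp z / r₁`.
-/

noncomputable section

namespace FractionalQueue

open Set Filter Topology

/-! ### Laplace transforms and causal convolutions -/

section Laplace

/-- The Laplace transform on `(0, ∞)` of a function with values in `[0, ∞]`, which exists without
any convergence assumption. -/
def laplaceLIntegral (f : ℝ → ENNReal) (s : ℝ) : ENNReal :=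
  ∫⁻ t in Ioi 0, ENNReal.ofReal (Real.exp (-s * t)) * f t

/-- The convolution `∫₀ᵗ k (t - u) f u du` of functions supported on `[0, ∞)`.  The left endpoint is
kept in the domain because it carries the renewal at time `0`. -/
def causalConv (k f : ℝ → ENNReal) (t : ℝ) : ENNReal :=
  ∫⁻ u in Ico 0 t, k (t - u) * f u

lemma laplaceLIntegral_congr {f g : ℝ → ENNReal} (h : ∀ t, 0 < t → f t = g t) (s : ℝ) :
    laplaceLIntegral f s = laplaceLIntegral g s :=
  setLIntegral_congr_fun measurableSet_Ioi fun t ht => by simp only [h t ht]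

lemma laplaceLIntegral_add {f : ℝ → ENNReal} (hf : Measurable f) (g : ℝ → ENNReal) (s : ℝ) :
    laplaceLIntegral (fun t => f t + g t) s = laplaceLIntegral f s + laplaceLIntegral g s := by
  simp only [laplaceLIntegral, mul_add]
  exact lintegral_add_left (by fun_prop) _

lemma lintegral_Ioi_exp_mul_comp_sub (k : ℝ → ENNReal) (s u : ℝ) :
    ∫⁻ t in Ioi u, ENNReal.ofReal (Real.exp (-s * t)) * k (t - u) =
      ENNReal.ofReal (Real.exp (-s * u)) * laplaceLIntegral k s := by
  rw [← (measurePreserving_add_right volume u).setLIntegral_comp_preimage_emb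
    (measurableEmbedding_addRight u), preimage_add_const_Ioi, sub_self, laplaceLIntegral,
    ← lintegral_const_mul' _ _ ENNReal.ofReal_ne_top]
  refine lintegral_congr fun v => ?_
  rw [← mul_assoc, ← ENNReal.ofReal_mul (Real.exp_nonneg _), ← Real.exp_add, add_sub_cancel_right]
  ring_nf

lemma laplaceLIntegral_causalConv {k f : ℝ → ENNReal} (hk : Measurable k) (hf : Measurable f)
    (s : ℝ) :
    laplaceLIntegral (causalConv k f) s = laplaceLIntegral k s * laplaceLIntegral f s := by
  let e : ℝ → ENNReal := fun t => ENNReal.ofReal (Real.exp (-s * t))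
  have he : Measurable e := by fun_prop
  calc laplaceLIntegral (causalConv k f) s
      = ∫⁻ t in Ioi 0, ∫⁻ u in Ioi 0, {q : ℝ × ℝ | q.2 < q.1}.indicator
          (fun q => e q.1 * (k (q.1 - q.2) * f q.2)) (t, u) := by
        refine setLIntegral_congr_fun measurableSet_Ioi fun t _ => ?_
        change e t * causalConv k f t =
          ∫⁻ u in Ioi 0, (Iio t).indicator (fun u => e t * (k (t - u) * f u)) u
        rw [setLIntegral_indicator measurableSet_Iio, inter_comm, Ioi_inter_Iio,
          setLIntegral_congr Ioo_ae_eq_Ico, lintegral_const_mul' _ _ ENNReal.ofReal_ne_top,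
          causalConv]
    _ = ∫⁻ u in Ioi 0, ∫⁻ t in Ioi 0, {q : ℝ × ℝ | q.2 < q.1}.indicator
          (fun q => e q.1 * (k (q.1 - q.2) * f q.2)) (t, u) :=
        lintegral_lintegral_swap (Measurable.indicator (by fun_prop)
          (measurableSet_lt measurable_snd measurable_fst)).aemeasurable
    _ = ∫⁻ u in Ioi 0, laplaceLIntegral k s * (e u * f u) := by
        refine setLIntegral_congr_fun measurableSet_Ioi fun u hu => ?_
        change ∫⁻ t in Ioi 0, (Ioi u).indicator (fun t => e t * (k (t - u) * f u)) t = _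
        simp_rw [setLIntegral_indicator measurableSet_Ioi,
          inter_eq_self_of_subset_left (Ioi_subset_Ioi (mem_Ioi.1 hu).le), ← mul_assoc]
        rw [lintegral_mul_const _ (by fun_prop), lintegral_Ioi_exp_mul_comp_sub,
          mul_comm (laplaceLIntegral k s)]
    _ = laplaceLIntegral k s * laplaceLIntegral f s := lintegral_const_mul _ (by fun_prop)

/-- A Chernoff bound: `∫ₜ^∞ s e^{-su} f t du ≤ s ∫₀^∞ e^{-su} f u du`. -/
lemma le_laplaceLIntegral_of_monotoneOn {f : ℝ → ENNReal} {s t : ℝ} (hs : 0 < s) (ht : 0 ≤ t)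
    (hf : MonotoneOn f (Ici t)) :
    f t ≤ ENNReal.ofReal (s * Real.exp (s * t)) * laplaceLIntegral f s := by
  have hexp : ∫⁻ u in Ioi t, ENNReal.ofReal (Real.exp (-s * u)) =
      ENNReal.ofReal (s * Real.exp (s * t))⁻¹ := by
    rw [← ofReal_integral_eq_lintegral_ofReal (integrableOn_exp_mul_Ioi (neg_lt_zero.2 hs) t)
      (ae_of_all _ fun u => Real.exp_nonneg _), integral_exp_mul_Ioi (neg_lt_zero.2 hs), mul_inv,
      ← Real.exp_neg, neg_mul]
    congr 1
    field_simp
  have hpos : 0 < s * Real.exp (s * t) := by positivity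
  calc f t = ENNReal.ofReal (s * Real.exp (s * t)) *
        ((∫⁻ u in Ioi t, ENNReal.ofReal (Real.exp (-s * u))) * f t) := by
        rw [hexp, ← mul_assoc, ← ENNReal.ofReal_mul hpos.le, mul_inv_cancel₀ hpos.ne',
          ENNReal.ofReal_one, one_mul]
    _ = ENNReal.ofReal (s * Real.exp (s * t)) *
        ∫⁻ u in Ioi t, ENNReal.ofReal (Real.exp (-s * u)) * f t := by
        rw [lintegral_mul_const _ (by fun_prop)]
    _ ≤ ENNReal.ofReal (s * Real.exp (s * t)) * laplaceLIntegral f s := by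
        gcongr
        refine (setLIntegral_mono' measurableSet_Ioi fun u hu => ?_).trans
          (lintegral_mono_set (Ioi_subset_Ioi ht))
        gcongr
        exact hf self_mem_Ici (mem_Ici_of_Ioi hu) (mem_Ioi.1 hu).le

end Laplace

/-! ### The Riemann–Liouville kernel -/

section Kernel

/-- The Riemann–Liouville kernel `t^(a-1) / Γ(a)`: convolution with it on `(0, t)` is the fractional
integral of order `a`.  The monomial `t^b / Γ(b+1)` is the kernel of order `b + 1`. -/
def rlKernel (a t : ℝ) : ℝ :=
  t ^ (a - 1) / Real.Gamma a

variable {a b s t : ℝ}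

lemma rlKernel_nonneg (ha : 0 < a) (ht : 0 ≤ t) : 0 ≤ rlKernel a t :=
  div_nonneg (Real.rpow_nonneg ht _) (Real.Gamma_pos_of_pos ha).le

lemma rlKernel_one (t : ℝ) : rlKernel 1 t = 1 := by
  simp [rlKernel]

lemma rlKernel_zero_right (ha : a ≠ 1) : rlKernel a 0 = 0 := by
  rw [rlKernel, Real.zero_rpow (sub_ne_zero.2 ha), zero_div]

lemma mul_rlKernel (ha : a ≠ 0) (ht : 0 < t) : t * rlKernel a t = a * rlKernel (a + 1) t := by
  rw [rlKernel, rlKernel, Real.Gamma_add_one ha, add_sub_cancel_right, Real.rpow_sub_one ht.ne']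
  field_simp

@[fun_prop]
lemma measurable_rlKernel (a : ℝ) : Measurable (rlKernel a) := by
  unfold rlKernel
  fun_prop

lemma continuous_rlKernel (ha : 1 ≤ a) : Continuous (rlKernel a) :=
  (Real.continuous_rpow_const (sub_nonneg.2 ha)).div_const _

lemma monotoneOn_rlKernel (ha : 1 ≤ a) : MonotoneOn (rlKernel a) (Ici 0) := fun x hx y _ hxy =>
  div_le_div_of_nonneg_right (Real.rpow_le_rpow hx hxy (sub_nonneg.2 ha))
    (Real.Gamma_pos_of_pos (by linarith)).le

lemma hasDerivAt_rlKernel_add_one (a : ℝ) (ht : 0 < t) :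
    HasDerivAt (rlKernel (a + 1)) (rlKernel a t) t := by
  have h := (Real.hasDerivAt_rpow_const (p := a) (Or.inl ht.ne')).div_const (Real.Gamma (a + 1))
  have hfun : rlKernel (a + 1) = fun x => x ^ a / Real.Gamma (a + 1) :=
    funext fun x => by rw [rlKernel, add_sub_cancel_right]
  rw [hfun, rlKernel]
  refine h.congr_deriv ?_
  rcases eq_or_ne a 0 with rfl | ha
  · simp
  · rw [Real.Gamma_add_one ha, mul_div_mul_left _ _ ha]

/-- Up to the factors `Γ(a)` and `Γ(b)` this is Euler's beta integral. -/
lemma integral_rlKernel_mul_rlKernel (ha : 0 < a) (hb : 0 < b) (ht : 0 < t) :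
    ∫ u in Ioo 0 t, rlKernel a (t - u) * rlKernel b u = rlKernel (a + b) t := by
  have h := Complex.betaIntegral_scaled b a ht
  rw [Complex.betaIntegral_eq_Gamma_mul_div _ _ (by simpa) (by simpa),
    intervalIntegral.integral_of_le ht.le, integral_Ioc_eq_integral_Ioo,
    setIntegral_congr_fun (g := fun u => (((t - u) ^ (a - 1) * u ^ (b - 1) : ℝ) : ℂ))
      measurableSet_Ioo fun u hu => ?_, integral_complex_ofReal,
    ← Complex.ofReal_add, ← Complex.ofReal_one, ← Complex.ofReal_sub, ← Complex.ofReal_cpow ht.le,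
    Complex.Gamma_ofReal, Complex.Gamma_ofReal, Complex.Gamma_ofReal] at h
  · norm_cast at h
    have hab : ∀ u, rlKernel a (t - u) * rlKernel b u =
        (t - u) ^ (a - 1) * u ^ (b - 1) / (Real.Gamma a * Real.Gamma b) := fun u => by
      rw [rlKernel, rlKernel, div_mul_div_comm]
    simp_rw [hab, integral_div, h, rlKernel, add_comm b a]
    have hΓa := (Real.Gamma_pos_of_pos ha).ne'
    have hΓb := (Real.Gamma_pos_of_pos hb).ne'
    field_simp
  · dsimp only
    rw [Complex.ofReal_mul, Complex.ofReal_cpow (sub_nonneg.2 hu.2.le), Complex.ofReal_cpow hu.1.le]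
    push_cast
    ring

lemma integrableOn_rlKernel_mul_rlKernel (ha : 0 < a) (hb : 0 < b) (ht : 0 < t) :
    IntegrableOn (fun u => rlKernel a (t - u) * rlKernel b u) (Ioo 0 t) := by
  refine Integrable.of_integral_ne_zero ?_
  rw [integral_rlKernel_mul_rlKernel ha hb ht]
  exact div_ne_zero (Real.rpow_pos_of_pos ht _).ne' (Real.Gamma_pos_of_pos (add_pos ha hb)).ne'

lemma laplaceLIntegral_rlKernel (ha : 0 < a) (hs : 0 < s) :
    laplaceLIntegral (fun t => ENNReal.ofReal (rlKernel a t)) s = ENNReal.ofReal (s ^ (-a)) := by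
  have hΓ := (Real.Gamma_pos_of_pos ha).ne'
  have hcongr : ∀ t, Real.exp (-s * t) * rlKernel a t =
      t ^ (a - 1) * Real.exp (-(s * t)) / Real.Gamma a := fun t => by
    rw [rlKernel, neg_mul]
    ring
  have hint : ∫ t in Ioi 0, Real.exp (-s * t) * rlKernel a t = s ^ (-a) := by
    simp_rw [hcongr, integral_div, Real.integral_rpow_mul_exp_neg_mul_Ioi ha hs, one_div,
      Real.inv_rpow hs.le, Real.rpow_neg hs.le]
    field_simp
  have hsa : 0 < s ^ (-a) := Real.rpow_pos_of_pos hs _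
  rw [← hint, ofReal_integral_eq_lintegral_ofReal
    (Integrable.of_integral_ne_zero (hint.trans_ne hsa.ne'))
    ((ae_restrict_iff' measurableSet_Ioi).2 (ae_of_all _ fun t ht =>
      mul_nonneg (Real.exp_nonneg _) (rlKernel_nonneg ha (mem_Ioi.1 ht).le)))]
  simp_rw [ENNReal.ofReal_mul (Real.exp_nonneg _)]
  rfl

lemma rlKernel_le_exp_mul_rpow (ha : 1 ≤ a) (hs : 0 < s) (ht : 0 ≤ t) :
    rlKernel a t ≤ Real.exp (s * t) * s ^ (1 - a) := by
  have h := le_laplaceLIntegral_of_monotoneOn hs ht (f := fun u => ENNReal.ofReal (rlKernel a u))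
    fun x hx y hy hxy => ENNReal.ofReal_le_ofReal
      (monotoneOn_rlKernel ha (ht.trans hx) (ht.trans hy) hxy)
  rw [laplaceLIntegral_rlKernel (by linarith) hs, ← ENNReal.ofReal_mul (by positivity),
    ENNReal.ofReal_le_ofReal_iff (by positivity)] at h
  rw [sub_eq_add_neg, Real.rpow_add hs, Real.rpow_one]
  linarith

end Kernel

/-! ### Fractional power series -/

section FracSeries

/-- At most exponential growth: the condition under which the fractional power series with these
coefficients converges on the whole half-line. -/
def ExpBounded (b : ℕ → ℝ) : Prop :=
  ∃ K C : ℝ, 0 ≤ C ∧ ∀ m, |b m| ≤ K * C ^ m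

/-- The fractional power series `∑ b m * t^(α m + β - 1) / Γ(α m + β)`.  Fractional integration of
order `γ` replaces `β` by `β + γ`. -/
def fracSeries (α β : ℝ) (b : ℕ → ℝ) (t : ℝ) : ℝ :=
  ∑' m : ℕ, b m * rlKernel (α * m + β) t

variable {α β γ : ℝ} {b : ℕ → ℝ} {t : ℝ}

lemma integrable_tsum_of_summable_integral_norm {ι X E : Type*} [Countable ι] [MeasurableSpace X]
    [NormedAddCommGroup E] [CompleteSpace E] {ν : Measure X} {f : ι → X → E}
    (hf : ∀ i, Integrable (f i) ν) (hs : Summable fun i => ∫ x, ‖f i x‖ ∂ν) :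
    Integrable (fun x => ∑' i, f i x) ν := by
  refine ⟨.tsum fun i => (hf i).1,
    (lintegral_mono fun x => enorm_tsum_le_tsum_enorm).trans_lt ?_⟩
  rw [lintegral_tsum fun i => (hf i).1.enorm]
  simp_rw [← ofReal_integral_norm_eq_lintegral_enorm (hf _)]
  exact hs.tsum_ofReal_lt_top

lemma rlKernel_le_div_mul (hβ : 0 < β) {x y : ℝ} (hx : 0 < x) (hxy : x ≤ y) :
    rlKernel β x ≤ y / x * rlKernel β y := by
  rw [div_mul_eq_mul_div, le_div_iff₀ hx, mul_comm, mul_rlKernel hβ.ne' hx,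
    mul_rlKernel hβ.ne' (hx.trans_le hxy)]
  exact mul_le_mul_of_nonneg_left
    (monotoneOn_rlKernel (by linarith) hx.le (hx.le.trans hxy) hxy) hβ.le

lemma ExpBounded.abs (hb : ExpBounded b) : ExpBounded fun m => |b m| := by
  simpa only [ExpBounded, abs_abs] using hb

lemma ExpBounded.shift (hb : ExpBounded b) : ExpBounded fun m => b (m + 1) := by
  obtain ⟨K, C, hC, h⟩ := hb
  exact ⟨K * C, C, hC, fun m => (h (m + 1)).trans_eq (by ring)⟩

/-- By the Chernoff bound for the kernel at `s = (C + 1)^(1/α)`, the terms decay like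
`(C / (C + 1))^m`. -/
lemma ExpBounded.summable_mul_rlKernel (hb : ExpBounded b) (hα : 0 < α) (β : ℝ) (ht : 0 ≤ t) :
    Summable fun m : ℕ => b m * rlKernel (α * m + β) t := by
  obtain ⟨K, C, hC, h⟩ := hb
  obtain ⟨s, hs, hsα⟩ : ∃ s : ℝ, 0 < s ∧ s ^ α = C + 1 :=
    ⟨(C + 1) ^ α⁻¹, by positivity, Real.rpow_inv_rpow (by positivity) hα.ne'⟩
  have hlarge : ∀ᶠ m : ℕ in atTop, 1 ≤ α * m + β := by
    have := tendsto_natCast_atTop_atTop.const_mul_atTop hα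
    filter_upwards [(tendsto_atTop_add_const_right _ β this).eventually_ge_atTop 1] with m hm
    exact hm
  have hgeom : Summable fun m : ℕ => K * Real.exp (s * t) * s ^ (1 - β) * (C / (C + 1)) ^ m :=
    (summable_geometric_of_lt_one (by positivity) ((div_lt_one (by positivity)).2
      (lt_add_one C))).mul_left _
  refine hgeom.of_norm_bounded_eventually_nat ?_
  filter_upwards [hlarge] with m hm
  rw [norm_mul, Real.norm_eq_abs, Real.norm_of_nonneg (rlKernel_nonneg (by linarith) ht)]
  calc |b m| * rlKernel (α * m + β) t
      ≤ K * C ^ m * (Real.exp (s * t) * s ^ (1 - (α * m + β))) :=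
        mul_le_mul (h m) (rlKernel_le_exp_mul_rpow hm hs ht) (rlKernel_nonneg (by linarith) ht)
          ((abs_nonneg _).trans (h m))
    _ = K * Real.exp (s * t) * s ^ (1 - β) * (C / (C + 1)) ^ m := by
        rw [show 1 - (α * m + β) = 1 - β - α * m by ring, Real.rpow_sub hs, Real.rpow_mul hs.le,
          Real.rpow_natCast, hsα, div_pow]
        ring

lemma fracSeries_zero_right (hα : 0 ≤ α) (hβ : 1 < β) (b : ℕ → ℝ) : fracSeries α β b 0 = 0 := by
  have hexp (m : ℕ) : α * m + β ≠ 1 := (lt_add_of_nonneg_of_lt (by positivity) hβ).ne'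
  simp [fracSeries, rlKernel_zero_right, hexp]

lemma ExpBounded.fracSeries_eq_add_shift (hb : ExpBounded b) (hα : 0 < α) (β : ℝ) (ht : 0 ≤ t) :
    fracSeries α β b t = b 0 * rlKernel β t + fracSeries α (β + α) (fun m => b (m + 1)) t := by
  rw [fracSeries, (hb.summable_mul_rlKernel hα β ht).tsum_eq_zero_add, Nat.cast_zero, mul_zero,
    zero_add, fracSeries]
  congr 1
  refine tsum_congr fun m => ?_
  rw [Nat.cast_succ, mul_add_one, add_right_comm, add_assoc]

section FracIntegral

variable (hb : ExpBounded b) (hα : 0 < α) (hγ : 0 < γ) (hβ : 0 < β) (ht : 0 < t)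
include hα hγ hβ ht

lemma integrableOn_rlKernel_mul_fracSeries_term (b : ℕ → ℝ) (m : ℕ) :
    IntegrableOn (fun u => rlKernel γ (t - u) * (b m * rlKernel (α * m + β) u)) (Ioo 0 t) :=
  IntegrableOn.congr_fun
    ((integrableOn_rlKernel_mul_rlKernel hγ (show 0 < α * m + β by positivity) ht).const_mul (b m))
    (fun _ _ => mul_left_comm _ _ _) measurableSet_Ioo

lemma integral_rlKernel_mul_fracSeries_term (b : ℕ → ℝ) (m : ℕ) :
    ∫ u in Ioo 0 t, rlKernel γ (t - u) * (b m * rlKernel (α * m + β) u) =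
      b m * rlKernel (α * m + (γ + β)) t := by
  simp_rw [mul_left_comm _ (b m), integral_const_mul]
  rw [integral_rlKernel_mul_rlKernel hγ (by positivity) ht, add_left_comm]

include hb

lemma ExpBounded.summable_integral_norm_fracSeries_term :
    Summable fun m : ℕ =>
      ∫ u in Ioo 0 t, ‖rlKernel γ (t - u) * (b m * rlKernel (α * m + β) u)‖ := by
  refine (hb.abs.summable_mul_rlKernel hα (γ + β) ht.le).congr fun m => ?_
  rw [← integral_rlKernel_mul_fracSeries_term hα hγ hβ ht fun m => |b m|]
  refine setIntegral_congr_fun measurableSet_Ioo fun u hu => ?_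
  rw [norm_mul, norm_mul, Real.norm_of_nonneg (rlKernel_nonneg hγ (sub_nonneg.2 hu.2.le)),
    Real.norm_of_nonneg (rlKernel_nonneg (by positivity) hu.1.le), Real.norm_eq_abs]

lemma ExpBounded.integrableOn_rlKernel_mul_fracSeries :
    IntegrableOn (fun u => rlKernel γ (t - u) * fracSeries α β b u) (Ioo 0 t) := by
  simp only [fracSeries, ← tsum_mul_left]
  exact integrable_tsum_of_summable_integral_norm
    (integrableOn_rlKernel_mul_fracSeries_term hα hγ hβ ht b)
    (hb.summable_integral_norm_fracSeries_term hα hγ hβ ht)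

lemma ExpBounded.integral_rlKernel_mul_fracSeries :
    ∫ u in Ioo 0 t, rlKernel γ (t - u) * fracSeries α β b u = fracSeries α (γ + β) b t := by
  simp only [fracSeries, ← tsum_mul_left]
  rw [← integral_tsum_of_summable_integral_norm
    (integrableOn_rlKernel_mul_fracSeries_term hα hγ hβ ht b)
    (hb.summable_integral_norm_fracSeries_term hα hγ hβ ht)]
  exact tsum_congr (integral_rlKernel_mul_fracSeries_term hα hγ hβ ht b)

end FracIntegral

lemma ExpBounded.continuousOn_fracSeries (hb : ExpBounded b) (hα : 0 < α) (hβ : 1 ≤ β) (t : ℝ) :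
    ContinuousOn (fracSeries α β b) (Icc 0 t) := by
  rcases lt_or_ge t 0 with ht | ht
  · simp [Icc_eq_empty_of_lt ht]
  have hexp (m : ℕ) : 1 ≤ α * m + β := le_add_of_nonneg_of_le (by positivity) hβ
  refine continuousOn_tsum
    (fun m => ((continuous_rlKernel (hexp m)).const_mul (b m)).continuousOn)
    (hb.abs.summable_mul_rlKernel hα β ht) fun m x hx => ?_
  rw [norm_mul, Real.norm_eq_abs,
    Real.norm_of_nonneg (rlKernel_nonneg (zero_lt_one.trans_le (hexp m)) hx.1)]
  gcongr
  exact monotoneOn_rlKernel (hexp m) hx.1 ht hx.2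

lemma ExpBounded.hasDerivAt_fracSeries (hb : ExpBounded b) (hα : 0 < α) (hβ : 0 < β)
    (ht : 0 < t) : HasDerivAt (fracSeries α (β + 1) b) (fracSeries α β b t) t := by
  have hexp (m : ℕ) : 0 < α * m + β := by positivity
  have hmem : t ∈ Ioo (t / 2) (2 * t) := ⟨by linarith, by linarith⟩
  have hterm (m : ℕ) (y : ℝ) (hy : y ∈ Ioo (t / 2) (2 * t)) :
      HasDerivAt (fun y => b m * rlKernel (α * m + (β + 1)) y)
        (b m * rlKernel (α * m + β) y) y := by
    rw [← add_assoc]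
    exact (hasDerivAt_rlKernel_add_one _ ((half_pos ht).trans hy.1)).const_mul _
  have hbound (m : ℕ) (y : ℝ) (hy : y ∈ Ioo (t / 2) (2 * t)) :
      ‖b m * rlKernel (α * m + β) y‖ ≤ 4 * (|b m| * rlKernel (α * m + β) (2 * t)) := by
    have hy0 : 0 < y := (half_pos ht).trans hy.1
    rw [norm_mul, Real.norm_eq_abs, Real.norm_of_nonneg (rlKernel_nonneg (hexp m) hy0.le),
      mul_left_comm]
    gcongr
    refine (rlKernel_le_div_mul (hexp m) hy0 hy.2.le).trans ?_
    gcongr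
    · exact rlKernel_nonneg (hexp m) (by positivity)
    · rw [div_le_iff₀ hy0]
      linarith [hy.1]
  exact hasDerivAt_tsum_of_isPreconnected
    ((hb.abs.summable_mul_rlKernel hα β (mul_pos two_pos ht).le).mul_left 4) isOpen_Ioo
    isPreconnected_Ioo hterm hbound hmem (hb.summable_mul_rlKernel hα (β + 1) ht.le) hmem

/-- The derivative `fracSeries α α (b ∘ succ)` of the series is integrated back to order `1` by the
kernel of order `1 - α`. -/
theorem ExpBounded.hasCaputoDerivAt_fracSeries (hb : ExpBounded b) (hα : 0 < α) (hα1 : α ≤ 1)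
    {f : ℝ → ℝ} (hf : ∀ t, 0 ≤ t → f t = fracSeries α 1 b t) (ht : 0 < t) :
    HasCaputoDerivAt α f (fracSeries α 1 (fun m => b (m + 1)) t) t := by
  have hcont : ContinuousOn f (Icc 0 t) :=
    (hb.continuousOn_fracSeries hα le_rfl t).congr fun u hu => hf u hu.1
  have hderiv : ∀ u, 0 < u → HasDerivAt f (fracSeries α α (fun m => b (m + 1)) u) u :=
    fun u hu => by
      refine ((hb.shift.hasDerivAt_fracSeries hα hα hu).const_add (b 0)).congr_of_eventuallyEq ?_
      filter_upwards [lt_mem_nhds hu] with v hv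
      rw [hf v hv.le, hb.fracSeries_eq_add_shift hα 1 hv.le, rlKernel_one, mul_one, add_comm 1]
  rcases eq_or_ne α 1 with rfl | hne
  · rw [HasCaputoDerivAt, if_pos rfl]
    exact ⟨hcont, hderiv t ht⟩
  have hα' : 0 < 1 - α := sub_pos.2 (hα1.lt_of_ne hne)
  have hΓ : Real.Gamma (1 - α) ≠ 0 := (Real.Gamma_pos_of_pos hα').ne'
  have hintegrand : EqOn (fun u => (t - u) ^ (-α) * deriv f u) (fun u => Real.Gamma (1 - α) *
      (rlKernel (1 - α) (t - u) * fracSeries α α (fun m => b (m + 1)) u)) (Ioo 0 t) :=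
    fun u hu => by
      dsimp only
      rw [(hderiv u hu.1).deriv, rlKernel, sub_sub_cancel_left]
      field_simp
  rw [HasCaputoDerivAt, if_neg hne]
  refine ⟨hcont, fun u hu => (hderiv u hu.1).differentiableAt, ?_, ?_⟩
  · exact IntegrableOn.congr_fun
      ((hb.shift.integrableOn_rlKernel_mul_fracSeries hα hα' hα ht).const_mul _)
      hintegrand.symm measurableSet_Ioo
  · rw [setIntegral_congr_fun measurableSet_Ioo hintegrand, integral_const_mul,
      hb.shift.integral_rlKernel_mul_fracSeries hα hα' hα ht, sub_add_cancel]
    field_simp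

lemma mittagLeffler_neg_rpow (α : ℝ) (ht : 0 ≤ t) :
    mittagLeffler α 1 (-(t ^ α)) = fracSeries α 1 (fun m => (-1) ^ m) t := by
  refine tsum_congr fun m => ?_
  rw [rlKernel, add_sub_cancel_right, Real.rpow_mul_natCast ht, neg_pow, mul_div_assoc, add_comm 1]

lemma one_sub_mittagLeffler (hα : 0 < α) (ht : 0 ≤ t) :
    1 - mittagLeffler α 1 (-(t ^ α)) =
      ∫ u in Ioo 0 t, rlKernel α (t - u) * mittagLeffler α 1 (-(u ^ α)) := by
  have hb : ExpBounded fun m => (-1 : ℝ) ^ m := ⟨1, 1, zero_le_one, by simp⟩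
  have hint : ∫ u in Ioo 0 t, rlKernel α (t - u) * mittagLeffler α 1 (-(u ^ α)) =
      fracSeries α (α + 1) (fun m => (-1) ^ m) t := by
    rcases ht.eq_or_lt with rfl | ht
    · simp [fracSeries_zero_right hα.le (lt_add_of_pos_left 1 hα)]
    · rw [← hb.integral_rlKernel_mul_fracSeries hα hα one_pos ht]
      exact setIntegral_congr_fun measurableSet_Ioo fun u hu => by
        simp only [mittagLeffler_neg_rpow α hu.1.le]
  rw [hint, mittagLeffler_neg_rpow α ht, hb.fracSeries_eq_add_shift hα 1 ht]
  simp [fracSeries, pow_succ, tsum_neg, rlKernel_one, add_comm 1 α]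

end FracSeries

/-! ### Fractional Taylor expansion -/

section Taylor

variable {α K D t₀ : ℝ} {f : ℕ → ℝ → ℝ} {c : ℕ → ℝ}

lemma integrableOn_rlKernel_mul_of_bounded (hα : 0 < α) {g : ℝ → ℝ} (hg : Measurable g)
    {B t : ℝ} (ht : 0 < t) (hB : ∀ u ∈ Ioo 0 t, |g u| ≤ B) :
    IntegrableOn (fun u => rlKernel α (t - u) * g u) (Ioo 0 t) := by
  have hκ : IntegrableOn (fun u => rlKernel α (t - u)) (Ioo 0 t) := by
    simpa only [rlKernel_one, mul_one] using integrableOn_rlKernel_mul_rlKernel hα one_pos ht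
  exact hκ.mul_bdd hg.aestronglyMeasurable
    ((ae_restrict_iff' measurableSet_Ioo).2 (ae_of_all _ hB))

lemma integrableOn_rlKernel_mul_sum (hα : 0 < α) {t : ℝ} (ht : 0 < t) (c : ℕ → ℝ) (m : ℕ) :
    IntegrableOn (fun u => rlKernel α (t - u) *
      ∑ k ∈ Finset.range m, c k * rlKernel (α * k + 1) u) (Ioo 0 t) := by
  simp only [Finset.mul_sum]
  exact integrable_finsetSum _ fun k _ =>
    integrableOn_rlKernel_mul_fracSeries_term hα hα one_pos ht c k

lemma integral_rlKernel_mul_sum (hα : 0 < α) {t : ℝ} (ht : 0 < t) (c : ℕ → ℝ) (m : ℕ) :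
    ∫ u in Ioo 0 t, rlKernel α (t - u) * ∑ k ∈ Finset.range m, c k * rlKernel (α * k + 1) u =
      ∑ k ∈ Finset.range m, c k * rlKernel (α * (k + 1 : ℕ) + 1) t := by
  simp only [Finset.mul_sum]
  rw [integral_finsetSum _ fun k _ =>
    integrableOn_rlKernel_mul_fracSeries_term hα hα one_pos ht c k]
  refine Finset.sum_congr rfl fun k _ => ?_
  rw [integral_rlKernel_mul_fracSeries_term hα hα one_pos ht c]
  push_cast
  ring_nf

section

variable (hα : 0 < α) (hmeas : ∀ m, Measurable (f m))
  (hbound : ∀ m t, 0 ≤ t → t ≤ t₀ → |f m t| ≤ K * D ^ m)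
  (hf : ∀ m t, 0 ≤ t → t ≤ t₀ →
    f m t = c m + ∫ u in Ioo 0 t, rlKernel α (t - u) * f (m + 1) u)
include hα hmeas hbound hf

lemma abs_sub_sum_rlKernel_le (m j : ℕ) {t : ℝ} (ht : 0 < t) (ht₀ : t ≤ t₀) :
    |f j t - ∑ k ∈ Finset.range m, c (j + k) * rlKernel (α * k + 1) t| ≤
      K * D ^ (j + m) * rlKernel (α * m + 1) t := by
  induction m generalizing j t with
  | zero => simpa [rlKernel_one] using hbound j t ht.le ht₀
  | succ m ih =>
    have hremainder : f j t - ∑ k ∈ Finset.range (m + 1), c (j + k) * rlKernel (α * k + 1) t =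
        ∫ u in Ioo 0 t, rlKernel α (t - u) *
          (f (j + 1) u - ∑ k ∈ Finset.range m, c (j + (k + 1)) * rlKernel (α * k + 1) u) := by
      simp_rw [mul_sub]
      rw [integral_sub (integrableOn_rlKernel_mul_of_bounded hα (hmeas (j + 1)) ht fun u hu =>
          hbound (j + 1) u hu.1.le (hu.2.le.trans ht₀))
          (integrableOn_rlKernel_mul_sum hα ht (fun k => c (j + (k + 1))) m),
        integral_rlKernel_mul_sum hα ht fun k => c (j + (k + 1)), Finset.sum_range_succ',
        hf j t ht.le ht₀]
      simp only [Nat.cast_zero, mul_zero, zero_add, add_zero, rlKernel_one, mul_one]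
      ring
    have hmaj := integrableOn_rlKernel_mul_fracSeries_term hα hα one_pos ht
      (fun m => K * D ^ (j + 1 + m)) m
    rw [hremainder, ← Real.norm_eq_abs]
    refine (norm_integral_le_of_norm_le hmaj ((ae_restrict_iff' measurableSet_Ioo).2
      (ae_of_all _ fun u hu => ?_))).trans_eq ?_
    · rw [norm_mul, Real.norm_of_nonneg (rlKernel_nonneg hα (sub_nonneg.2 hu.2.le))]
      gcongr
      · exact rlKernel_nonneg hα (sub_nonneg.2 hu.2.le)
      · simpa only [Real.norm_eq_abs, add_assoc, add_comm 1] using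
          ih (j + 1) hu.1 (hu.2.le.trans ht₀)
    · rw [integral_rlKernel_mul_fracSeries_term hα hα one_pos ht fun m => K * D ^ (j + 1 + m)]
      push_cast
      ring_nf

/-- Iterating `f m = c m + I^α f (m + 1)` gives a fractional Taylor expansion of `f 0`. -/
theorem eq_fracSeries_of_eq_add_integral (hc : ExpBounded c) (hD : 0 ≤ D) (ht₀ : 0 ≤ t₀) :
    f 0 t₀ = fracSeries α 1 c t₀ := by
  rcases ht₀.eq_or_lt with rfl | ht₀
  · rw [hf 0 0 le_rfl le_rfl, hc.fracSeries_eq_add_shift hα 1 le_rfl,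
      fracSeries_zero_right hα.le (lt_add_of_pos_right 1 hα), rlKernel_one]
    simp
  have hrem : Tendsto (fun m : ℕ => K * D ^ m * rlKernel (α * m + 1) t₀) atTop (𝓝 0) := by
    have hKD : ExpBounded fun m => K * D ^ m := ⟨|K|, D, hD, fun m => by
      rw [abs_mul, abs_of_nonneg (pow_nonneg hD m)]⟩
    exact (hKD.summable_mul_rlKernel hα 1 ht₀.le).tendsto_atTop_zero
  have hsum := (hc.summable_mul_rlKernel hα 1 ht₀.le).hasSum.tendsto_sum_nat
  refine tendsto_nhds_unique (tendsto_iff_dist_tendsto_zero.2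
    (squeeze_zero (fun _ => dist_nonneg) (fun m => ?_) hrem)) hsum
  rw [dist_comm, Real.dist_eq]
  simpa using abs_sub_sum_rlKernel_le hα hmeas hbound hf m 0 ht₀ le_rfl

end

end Taylor

/-! ### Renewal equations -/

section Renewal

variable {Ω : Type*} [MeasurableSpace Ω] {μ : Measure Ω}

lemma measure_prodMk_mem_of_indepFun [IsFiniteMeasure μ] {β γ : Type*} [MeasurableSpace β]
    [MeasurableSpace γ] {X : Ω → β} {Y : Ω → γ} (hX : Measurable X) (hY : Measurable Y)
    (hXY : IndepFun X Y μ) {A : Set (β × γ)} (hA : MeasurableSet A) :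
    μ {ω | (X ω, Y ω) ∈ A} = ∫⁻ ω, μ {ω' | (X ω, Y ω') ∈ A} ∂μ := by
  calc μ {ω | (X ω, Y ω) ∈ A} = ((μ.map X).prod (μ.map Y)) A := by
        rw [← (indepFun_iff_map_prod_eq_prod_map_map hX.aemeasurable hY.aemeasurable).1 hXY,
          Measure.map_apply (hX.prodMk hY) hA]
        rfl
    _ = ∫⁻ ω, μ {ω' | (X ω, Y ω') ∈ A} ∂μ := by
        rw [Measure.prod_apply hA, lintegral_map (measurable_measure_prodMk_left hA) hX]
        refine lintegral_congr fun ω => ?_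
        rw [Measure.map_apply hY (measurable_prodMk_left hA)]
        rfl

lemma causalConv_sub (k f : ℝ → ENNReal) {s : ℝ} (hs : 0 ≤ s) (t : ℝ) :
    causalConv k f (t - s) =
      ∫⁻ u in Ico 0 t, k (t - u) * (Ici s).indicator (fun u => f (u - s)) u := by
  simp_rw [← indicator_mul_right (Ici s) (fun u => k (t - u))]
  rw [setLIntegral_indicator measurableSet_Ici, show Ici s ∩ Ico 0 t = Ico s t by grind,
    ← (measurePreserving_add_right volume s).setLIntegral_comp_preimage_emb
      (measurableEmbedding_addRight s), preimage_add_const_Ico, sub_self, causalConv]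
  simp only [add_sub_cancel_right, sub_sub, add_comm s]

lemma causalConv_of_nonpos (k f : ℝ → ENNReal) {t : ℝ} (ht : t ≤ 0) : causalConv k f t = 0 := by
  rw [causalConv, Ico_eq_empty ht.not_gt, Measure.restrict_empty, lintegral_zero_measure]

lemma measurable_measure_lt (X : Ω → ℝ) : Measurable fun u => μ {ω | u < X ω} :=
  Antitone.measurable fun _ _ huv => measure_mono fun _ hω => lt_of_le_of_lt huv hω

lemma measure_le_and_lt_add [IsFiniteMeasure μ] {S X : Ω → ℝ} (hS : Measurable S)
    (hX : Measurable X) (hSX : IndepFun S X μ) (u : ℝ) :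
    μ {ω | S ω ≤ u ∧ u < S ω + X ω} =
      ∫⁻ ω, (Ici (S ω)).indicator (fun u => μ {ω' | u - S ω < X ω'}) u ∂μ := by
  have h := measure_prodMk_mem_of_indepFun hS hX hSX (A := {q | q.1 ≤ u ∧ u < q.1 + q.2})
    ((measurableSet_le measurable_fst measurable_const).inter
      (measurableSet_lt measurable_const (measurable_fst.add measurable_snd)))
  refine h.trans (lintegral_congr fun ω => ?_)
  by_cases hω : S ω ≤ u <;> simp [hω, sub_lt_iff_lt_add']

/-- If the law of a waiting time `X` solves a renewal equation with kernel `k`, then so does the law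
of the waiting time restarted at an independent time `S`: condition on `S` and interchange the
integrals. -/
theorem measure_add_le_eq_causalConv [IsFiniteMeasure μ] {k : ℝ → ENNReal}
    (hk : Measurable k) {S X : Ω → ℝ} (hS : Measurable S) (hX : Measurable X)
    (hSX : IndepFun S X μ) (hS0 : ∀ᵐ ω ∂μ, 0 ≤ S ω) (hX0 : ∀ᵐ ω ∂μ, 0 ≤ X ω)
    (hlaw : ∀ t, 0 ≤ t → μ {ω | X ω ≤ t} = causalConv k (fun u => μ {ω | u < X ω}) t) (t : ℝ) :
    μ {ω | S ω + X ω ≤ t} = causalConv k (fun u => μ {ω | S ω ≤ u ∧ u < S ω + X ω}) t := by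
  have hlaw' (s : ℝ) :
      μ {ω | X ω ≤ t - s} = causalConv k (fun u => μ {ω | u < X ω}) (t - s) := by
    rcases le_or_gt 0 (t - s) with h | h
    · exact hlaw _ h
    · rw [causalConv_of_nonpos _ _ h.le]
      exact measure_mono_null (fun ω hω => not_le.2 (lt_of_le_of_lt hω h)) hX0
  let g : Ω → ℝ → ENNReal := fun ω =>
    (Ici (S ω)).indicator fun u => μ {ω' | u - S ω < X ω'}
  have hg : Measurable fun q : Ω × ℝ => g q.1 q.2 :=
    Measurable.indicator (s := {q : Ω × ℝ | S q.1 ≤ q.2})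
      ((measurable_measure_lt X).comp (by fun_prop : Measurable fun q : Ω × ℝ => q.2 - S q.1))
      (measurableSet_le (hS.comp measurable_fst) measurable_snd)
  calc μ {ω | S ω + X ω ≤ t} = ∫⁻ ω, μ {ω' | X ω' ≤ t - S ω} ∂μ := by
        simp only [le_sub_iff_add_le']
        exact measure_prodMk_mem_of_indepFun hS hX hSX
          (measurableSet_le (measurable_fst.add measurable_snd) measurable_const)
    _ = ∫⁻ ω, (∫⁻ u in Ico 0 t, k (t - u) * g ω u) ∂μ := by
        refine lintegral_congr_ae (hS0.mono fun ω hω => ?_)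
        dsimp only
        rw [hlaw', causalConv_sub _ _ hω]
    _ = ∫⁻ u in Ico 0 t, (∫⁻ ω, k (t - u) * g ω u ∂μ) :=
        lintegral_lintegral_swap
          ((by fun_prop : Measurable fun q : Ω × ℝ => k (t - q.2)).mul hg).aemeasurable
    _ = causalConv k (fun u => μ {ω | S ω ≤ u ∧ u < S ω + X ω}) t := by
        refine lintegral_congr fun u => ?_
        dsimp only
        rw [measure_le_and_lt_add hS hX hSX, ← lintegral_const_mul]
        exact hg.comp measurable_prodMk_right

end Renewal

/-! ### The Mittag-Leffler renewal process -/

section Counting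

variable {Ω : Type*}

/-- The epoch of the `n`-th event, `T 0 + ⋯ + T (n - 1)`. -/
def partialSum (T : ℕ → Ω → ℝ) (n : ℕ) (ω : Ω) : ℝ :=
  ∑ i ∈ Finset.range n, T i ω

/-- The event `N(t) = n`, that exactly `n` renewals occur up to time `t`. -/
def countEvent (T : ℕ → Ω → ℝ) (n : ℕ) (t : ℝ) : Set Ω :=
  {ω | partialSum T n ω ≤ t ∧ t < partialSum T (n + 1) ω}

variable {T : ℕ → Ω → ℝ} {ω : Ω} {n : ℕ} {t : ℝ}

lemma partialSum_zero (T : ℕ → Ω → ℝ) (ω : Ω) : partialSum T 0 ω = 0 :=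
  Finset.sum_range_zero _

lemma partialSum_succ (T : ℕ → Ω → ℝ) (n : ℕ) (ω : Ω) :
    partialSum T (n + 1) ω = partialSum T n ω + T n ω :=
  Finset.sum_range_succ _ _

lemma partialSum_nonneg (hT : ∀ n, 0 < T n ω) (n : ℕ) : 0 ≤ partialSum T n ω :=
  Finset.sum_nonneg fun i _ => (hT i).le

lemma strictMono_partialSum (hT : ∀ n, 0 < T n ω) : StrictMono fun n => partialSum T n ω :=
  strictMono_nat_of_lt_succ fun n => by
    rw [partialSum_succ]
    exact lt_add_of_pos_right _ (hT n)

lemma countingProcess_eq_of_mem_countEvent (hT : ∀ n, 0 < T n ω) (hn : ω ∈ countEvent T n t) :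
    countingProcess T t ω = n := by
  have hsingleton : {k : ℕ | partialSum T k ω ≤ t ∧ t < partialSum T (k + 1) ω} = {n} := by
    refine eq_singleton_iff_unique_mem.2 ⟨hn, fun k hk => ?_⟩
    have hkn : k < n + 1 := (strictMono_partialSum hT).lt_iff_lt.1 (hk.1.trans_lt hn.2)
    have hnk : n < k + 1 := (strictMono_partialSum hT).lt_iff_lt.1 (hn.1.trans_lt hk.2)
    omega
  exact (congrArg sSup hsingleton).trans (csSup_singleton n)

lemma exists_mem_countEvent (ht : 0 ≤ t) (hn : t < partialSum T n ω) :
    ∃ k, ω ∈ countEvent T k t := by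
  classical
  have hex : ∃ n, t < partialSum T n ω := ⟨n, hn⟩
  obtain ⟨k, hk⟩ : ∃ k, Nat.find hex = k + 1 := Nat.exists_eq_succ_of_ne_zero fun h0 =>
    ((partialSum_zero T ω).trans_le ht).not_gt (by simpa only [h0] using Nat.find_spec hex)
  exact ⟨k, not_lt.1 (Nat.find_min hex (hk ▸ Nat.lt_succ_self k)), hk ▸ Nat.find_spec hex⟩

variable [MeasurableSpace Ω] {μ : Measure Ω}

lemma measurable_partialSum (hT : ∀ n, Measurable (T n)) (n : ℕ) : Measurable (partialSum T n) :=
  Finset.measurable_fun_sum _ fun i _ => hT i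

lemma measurableSet_countEvent (hT : ∀ n, Measurable (T n)) (n : ℕ) (t : ℝ) :
    MeasurableSet (countEvent T n t) :=
  (measurableSet_le (measurable_partialSum hT n) measurable_const).inter
    (measurableSet_lt measurable_const (measurable_partialSum hT (n + 1)))

lemma measurable_measure_countEvent [SFinite μ] (hT : ∀ n, Measurable (T n)) (n : ℕ) :
    Measurable fun t => μ (countEvent T n t) :=
  measurable_measure_prodMk_left (s := {q : ℝ × Ω | q.2 ∈ countEvent T n q.1})
    ((measurableSet_le ((measurable_partialSum hT n).comp measurable_snd) measurable_fst).inter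
      (measurableSet_lt measurable_fst ((measurable_partialSum hT (n + 1)).comp measurable_snd)))

end Counting

section MittagLefflerRenewal

variable {Ω : Type*} [MeasurableSpace Ω] {μ : Measure Ω} [IsProbabilityMeasure μ] {α : ℝ}

lemma IsMittagLefflerDistributed.measure_le_eq_causalConv {X : Ω → ℝ}
    (hX : IsMittagLefflerDistributed α X μ) (hα : 0 < α) (hXm : Measurable X) {t : ℝ}
    (ht : 0 ≤ t) :
    μ {ω | X ω ≤ t} =
      causalConv (fun v => ENNReal.ofReal (rlKernel α v)) (fun u => μ {ω | u < X ω}) t := by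
  have hsurv {u : ℝ} (hu : 0 ≤ u) : μ.real {ω | u < X ω} = mittagLeffler α 1 (-(u ^ α)) := by
    have hcompl : {ω | u < X ω} = {ω | X ω ≤ u}ᶜ := by ext; simp
    rw [hcompl, probReal_compl_eq_one_sub (measurableSet_le hXm measurable_const), hX u hu,
      sub_sub_cancel]
  have hreal : μ.real {ω | X ω ≤ t} =
      ∫ u in Ioo 0 t, rlKernel α (t - u) * μ.real {ω | u < X ω} := by
    rw [hX t ht, one_sub_mittagLeffler hα ht]
    exact setIntegral_congr_fun measurableSet_Ioo fun u hu => by simp only [hsurv hu.1.le]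
  rcases ht.eq_or_lt with rfl | ht
  · rw [causalConv_of_nonpos _ _ le_rfl, ← measureReal_eq_zero_iff, hreal]
    simp
  have hκ : ∀ u ∈ Ioo 0 t, 0 ≤ rlKernel α (t - u) := fun u hu =>
    rlKernel_nonneg hα (sub_nonneg.2 hu.2.le)
  have hmeas : Measurable fun u => μ.real {ω | u < X ω} :=
    (measurable_measure_lt X).ennreal_toReal
  have hint : IntegrableOn (fun u => rlKernel α (t - u) * μ.real {ω | u < X ω}) (Ioo 0 t) :=
    integrableOn_rlKernel_mul_of_bounded hα hmeas ht fun u _ =>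
      (abs_of_nonneg measureReal_nonneg).trans_le measureReal_le_one
  rw [← ofReal_measureReal, hreal, ofReal_integral_eq_lintegral_ofReal hint
    ((ae_restrict_iff' measurableSet_Ioo).2 (ae_of_all _ fun u hu =>
      mul_nonneg (hκ u hu) measureReal_nonneg)), causalConv, setLIntegral_congr Ioo_ae_eq_Ico.symm]
  exact setLIntegral_congr_fun measurableSet_Ioo fun u hu => by
    rw [ENNReal.ofReal_mul (hκ u hu), ofReal_measureReal]

variable {T : ℕ → Ω → ℝ} (hT : IsMittagLefflerRenewal α T μ) (hα : 0 < α)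
include hT hα

lemma IsMittagLefflerRenewal.ae_pos : ∀ᵐ ω ∂μ, ∀ n, 0 < T n ω := by
  refine ae_all_iff.2 fun n => ?_
  have h := (hT.law n).measure_le_eq_causalConv hα (hT.measurable n) le_rfl
  rw [causalConv_of_nonpos _ _ le_rfl] at h
  simpa only [ae_iff, not_lt] using h

lemma IsMittagLefflerRenewal.measure_partialSum_succ_le (n : ℕ) (t : ℝ) :
    μ {ω | partialSum T (n + 1) ω ≤ t} =
      causalConv (fun v => ENNReal.ofReal (rlKernel α v)) (fun u => μ (countEvent T n u)) t := by
  have hindep : IndepFun (partialSum T n) (T n) μ := by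
    have h := hT.indep.indepFun_finsetSum_of_notMem hT.measurable
      (Finset.notMem_range_self (n := n))
    rwa [show ∑ j ∈ Finset.range n, T j = partialSum T n from
      funext fun ω => Finset.sum_apply ω _ _] at h
  have hpos := hT.ae_pos hα
  simp only [countEvent, partialSum_succ]
  exact measure_add_le_eq_causalConv (by fun_prop) (measurable_partialSum hT.measurable n)
    (hT.measurable n) hindep (hpos.mono fun ω hω => partialSum_nonneg hω n)
    (hpos.mono fun ω hω => (hω n).le)
    (fun t ht => (hT.law n).measure_le_eq_causalConv hα (hT.measurable n) ht) t

lemma IsMittagLefflerRenewal.measure_countEvent_add (n : ℕ) (t : ℝ) :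
    μ (countEvent T n t) + μ {ω | partialSum T (n + 1) ω ≤ t} = μ {ω | partialSum T n ω ≤ t} := by
  have hmeas := measurableSet_le (measurable_partialSum hT.measurable (n + 1))
    (measurable_const (a := t))
  rw [← measure_inter_add_sdiff {ω | partialSum T n ω ≤ t} hmeas, add_comm]
  congr 1
  · refine measure_congr ((hT.ae_pos hα).mono fun ω hω => propext ?_)
    exact ⟨fun h => ⟨((strictMono_partialSum hω).monotone n.le_succ).trans h, h⟩, And.right⟩
  · simp only [countEvent, sdiff_eq, compl_ofPred, not_le, ofPred_and]

section Laplace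

variable {s : ℝ} (hs : 0 < s)
include hs

lemma IsMittagLefflerRenewal.laplaceLIntegral_partialSum_succ_le (n : ℕ) :
    laplaceLIntegral (fun t => μ {ω | partialSum T (n + 1) ω ≤ t}) s =
      ENNReal.ofReal (s ^ (-α)) * laplaceLIntegral (fun t => μ (countEvent T n t)) s := by
  rw [← laplaceLIntegral_rlKernel hα hs, ← laplaceLIntegral_causalConv (by fun_prop)
    (measurable_measure_countEvent hT.measurable n)]
  exact congrArg (laplaceLIntegral · s) (funext (hT.measure_partialSum_succ_le hα n))

lemma IsMittagLefflerRenewal.laplaceLIntegral_countEvent_eq_div (n : ℕ) :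
    laplaceLIntegral (fun t => μ (countEvent T n t)) s =
      laplaceLIntegral (fun t => μ {ω | partialSum T n ω ≤ t}) s /
        ENNReal.ofReal (1 + s ^ (-α)) := by
  have hsα : 0 < s ^ (-α) := Real.rpow_pos_of_pos hs _
  rw [ENNReal.eq_div_iff (ENNReal.ofReal_pos.2 (by positivity)).ne' ENNReal.ofReal_ne_top,
    ENNReal.ofReal_add zero_le_one hsα.le, ENNReal.ofReal_one, add_mul, one_mul,
    ← hT.laplaceLIntegral_partialSum_succ_le hα hs,
    ← laplaceLIntegral_add (measurable_measure_countEvent hT.measurable n)]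
  exact congrArg (laplaceLIntegral · s) (funext (hT.measure_countEvent_add hα n))

lemma IsMittagLefflerRenewal.laplaceLIntegral_partialSum_le (n : ℕ) :
    laplaceLIntegral (fun t => μ {ω | partialSum T n ω ≤ t}) s =
      ENNReal.ofReal (s⁻¹ / (1 + s ^ α) ^ n) := by
  induction n with
  | zero =>
    rw [pow_zero, div_one, ← Real.rpow_neg_one, ← laplaceLIntegral_rlKernel one_pos hs]
    refine laplaceLIntegral_congr (fun t ht => ?_) s
    simp [partialSum_zero, rlKernel_one, ht.le]
  | succ n ih =>
    rw [hT.laplaceLIntegral_partialSum_succ_le hα hs, hT.laplaceLIntegral_countEvent_eq_div hα hs,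
      ih, ← ENNReal.ofReal_div_of_pos (by positivity), ← ENNReal.ofReal_mul (by positivity),
      Real.rpow_neg hs.le]
    congr 1
    field_simp
    ring

theorem IsMittagLefflerRenewal.laplaceLIntegral_countEvent (n : ℕ) :
    laplaceLIntegral (fun t => μ (countEvent T n t)) s =
      ENNReal.ofReal (s ^ (α - 1) / (1 + s ^ α) ^ (n + 1)) := by
  rw [hT.laplaceLIntegral_countEvent_eq_div hα hs, hT.laplaceLIntegral_partialSum_le hα hs,
    ← ENNReal.ofReal_div_of_pos (by positivity), Real.rpow_neg hs.le, Real.rpow_sub_one hs.ne']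
  congr 1
  field_simp
  ring

lemma IsMittagLefflerRenewal.measureReal_partialSum_le_le (n : ℕ) {t : ℝ} (ht : 0 ≤ t) :
    μ.real {ω | partialSum T n ω ≤ t} ≤ Real.exp (s * t) / (1 + s ^ α) ^ n := by
  have h := le_laplaceLIntegral_of_monotoneOn hs ht
    (f := fun t => μ {ω | partialSum T n ω ≤ t})
    fun u _ v _ huv => measure_mono fun ω hω => le_trans hω huv
  rw [hT.laplaceLIntegral_partialSum_le hα hs, ← ENNReal.ofReal_mul (by positivity)] at h
  refine (ENNReal.toReal_le_of_le_ofReal (by positivity) h).trans_eq ?_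
  field_simp

end Laplace

/-- By the Chernoff bound at `s = (C + 1)^(1/α)`, the terms decay like `(C / (C + 2))^n`. -/
lemma IsMittagLefflerRenewal.summable_mul_measure_partialSum_le {b : ℕ → ℝ} (hb : ExpBounded b)
    {t : ℝ} (ht : 0 ≤ t) : Summable fun n => b n * μ.real {ω | partialSum T n ω ≤ t} := by
  obtain ⟨K, C, hC, h⟩ := hb
  obtain ⟨s, hs, hsα⟩ : ∃ s : ℝ, 0 < s ∧ s ^ α = C + 1 :=
    ⟨(C + 1) ^ α⁻¹, by positivity, Real.rpow_inv_rpow (by positivity) hα.ne'⟩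
  have hratio : C / (1 + (C + 1)) < 1 := (div_lt_one (by positivity)).2 (by linarith)
  refine ((summable_geometric_of_lt_one (by positivity) hratio).mul_left
    (K * Real.exp (s * t))).of_norm_bounded fun n => ?_
  rw [norm_mul, Real.norm_eq_abs, Real.norm_of_nonneg measureReal_nonneg]
  calc |b n| * μ.real {ω | partialSum T n ω ≤ t}
      ≤ K * C ^ n * (Real.exp (s * t) / (1 + s ^ α) ^ n) :=
        mul_le_mul (h n) (hT.measureReal_partialSum_le_le hα hs n ht) measureReal_nonneg
          ((abs_nonneg _).trans (h n))
    _ = K * Real.exp (s * t) * (C / (1 + (C + 1))) ^ n := by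
        rw [hsα, div_pow]
        ring

lemma IsMittagLefflerRenewal.ae_mem_countEvent_iff {t : ℝ} (ht : 0 ≤ t) :
    ∀ᵐ ω ∂μ, ∀ n, ω ∈ countEvent T n t ↔ n = countingProcess T t ω := by
  have hlim : Tendsto (fun n => μ.real {ω | partialSum T n ω ≤ t}) atTop (𝓝 0) := by
    have hb : ExpBounded fun _ => 1 := ⟨1, 1, zero_le_one, by simp⟩
    simpa only [one_mul] using
      (hT.summable_mul_measure_partialSum_le hα hb ht).tendsto_atTop_zero
  have hnull : μ.real {ω | ¬ ∃ n, t < partialSum T n ω} = 0 :=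
    le_antisymm (ge_of_tendsto' hlim fun n => measureReal_mono fun ω hω =>
      not_lt.1 fun h => hω ⟨n, h⟩) measureReal_nonneg
  have hae : ∀ᵐ ω ∂μ, ∃ n, t < partialSum T n ω :=
    (measureReal_eq_zero_iff (by finiteness)).1 hnull
  filter_upwards [hT.ae_pos hα, hae] with ω hpos hex n
  obtain ⟨k, hk⟩ := exists_mem_countEvent ht hex.choose_spec
  refine ⟨fun hn => (countingProcess_eq_of_mem_countEvent hpos hn).symm, ?_⟩
  rintro rfl
  rwa [countingProcess_eq_of_mem_countEvent hpos hk]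

end MittagLefflerRenewal

/-! ### Expectations of functions of the counting process -/

lemma abs_iterate_fwdDiff_le {b : ℕ → ℝ} {K C : ℝ} (hb : ∀ n, |b n| ≤ K * C ^ n) (m n : ℕ) :
    |(fwdDiff 1)^[m] b n| ≤ K * (C + 1) ^ m * C ^ n := by
  induction m generalizing n with
  | zero => simpa using hb n
  | succ m ih =>
    rw [Function.iterate_succ_apply', fwdDiff]
    refine ((abs_sub _ _).trans (add_le_add (ih (n + 1)) (ih n))).trans_eq ?_
    ring

lemma ExpBounded.iterate_fwdDiff {b : ℕ → ℝ} (hb : ExpBounded b) (m : ℕ) :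
    ExpBounded ((fwdDiff 1)^[m] b) :=
  let ⟨K, C, hC, h⟩ := hb
  ⟨K * (C + 1) ^ m, C, hC, abs_iterate_fwdDiff_le h m⟩

lemma ExpBounded.iterate_fwdDiff_zero {b : ℕ → ℝ} (hb : ExpBounded b) :
    ExpBounded fun m => (fwdDiff 1)^[m] b 0 :=
  let ⟨K, C, hC, h⟩ := hb
  ⟨K, C + 1, by positivity, fun m => by simpa using abs_iterate_fwdDiff_le h m 0⟩

/-- The expectation `E b(N(t)) = ∑ b n * P(N(t) = n)`, where `N` counts the renewals with
inter-event times `T`. -/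
def countMean {Ω : Type*} [MeasurableSpace Ω] (μ : Measure Ω) (T : ℕ → Ω → ℝ) (b : ℕ → ℝ)
    (t : ℝ) : ℝ :=
  ∑' n, b n * μ.real (countEvent T n t)

section CountMean

variable {Ω : Type*} [MeasurableSpace Ω] {μ : Measure Ω} {T : ℕ → Ω → ℝ}

lemma measureReal_countEvent_le [IsFiniteMeasure μ] (n : ℕ) {t t₀ : ℝ} (ht : t ≤ t₀) :
    μ.real (countEvent T n t) ≤ μ.real {ω | partialSum T n ω ≤ t₀} :=
  measureReal_mono fun _ hω => hω.1.trans ht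

lemma measurable_measureReal_countEvent [SFinite μ] (hT : ∀ n, Measurable (T n)) (n : ℕ) :
    Measurable fun t => μ.real (countEvent T n t) :=
  (measurable_measure_countEvent hT n).ennreal_toReal

lemma measurable_countMean [SFinite μ] (hT : ∀ n, Measurable (T n)) (b : ℕ → ℝ) :
    Measurable (countMean μ T b) :=
  Measurable.tsum fun n => (measurable_measureReal_countEvent hT n).const_mul (b n)

variable [IsProbabilityMeasure μ] {α : ℝ} (hT : IsMittagLefflerRenewal α T μ) (hα : 0 < α)
include hT hα

lemma IsMittagLefflerRenewal.measureReal_partialSum_succ_le (n : ℕ) (t : ℝ) :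
    μ.real {ω | partialSum T (n + 1) ω ≤ t} =
      ∫ u in Ioo 0 t, rlKernel α (t - u) * μ.real (countEvent T n u) := by
  have hκ : ∀ u ∈ Ioo 0 t, 0 ≤ rlKernel α (t - u) := fun u hu =>
    rlKernel_nonneg hα (sub_nonneg.2 hu.2.le)
  have hmeas := measurable_measureReal_countEvent (μ := μ) hT.measurable n
  rw [integral_eq_lintegral_of_nonneg_ae ((ae_restrict_iff' measurableSet_Ioo).2
    (ae_of_all _ fun u hu => mul_nonneg (hκ u hu) measureReal_nonneg)) (by fun_prop),
    measureReal_def, hT.measure_partialSum_succ_le hα, causalConv,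
    setLIntegral_congr Ioo_ae_eq_Ico.symm]
  congr 1
  exact setLIntegral_congr_fun measurableSet_Ioo fun u hu => by
    rw [ENNReal.ofReal_mul (hκ u hu), ofReal_measureReal]

lemma IsMittagLefflerRenewal.measureReal_countEvent (n : ℕ) (t : ℝ) :
    μ.real (countEvent T n t) =
      μ.real {ω | partialSum T n ω ≤ t} - μ.real {ω | partialSum T (n + 1) ω ≤ t} := by
  rw [eq_sub_iff_add_eq, measureReal_def, measureReal_def, measureReal_def,
    ← ENNReal.toReal_add (by finiteness) (by finiteness), hT.measure_countEvent_add hα]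

variable {b : ℕ → ℝ} (hb : ExpBounded b) {t : ℝ}
include hb

lemma IsMittagLefflerRenewal.summable_mul_measure_countEvent (ht : 0 ≤ t) :
    Summable fun n => b n * μ.real (countEvent T n t) :=
  (hT.summable_mul_measure_partialSum_le hα hb.abs ht).of_norm_bounded fun n => by
    rw [norm_mul, Real.norm_eq_abs, Real.norm_of_nonneg measureReal_nonneg]
    exact mul_le_mul_of_nonneg_left (measureReal_countEvent_le n le_rfl) (abs_nonneg _)

lemma IsMittagLefflerRenewal.summable_mul_measure_partialSum_succ_le (ht : 0 ≤ t) :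
    Summable fun n => b n * μ.real {ω | partialSum T (n + 1) ω ≤ t} :=
  ((hT.summable_mul_measure_partialSum_le hα hb ht).sub
    (hT.summable_mul_measure_countEvent hα hb ht)).congr fun n => by
      rw [hT.measureReal_countEvent hα]
      ring

lemma IsMittagLefflerRenewal.countMean_eq_add_tsum_fwdDiff (ht : 0 ≤ t) :
    countMean μ T b t =
      b 0 + ∑' n, fwdDiff 1 b n * μ.real {ω | partialSum T (n + 1) ω ≤ t} := by
  set F : ℕ → ℝ := fun n => μ.real {ω | partialSum T n ω ≤ t} with hF
  have hsum : Summable fun n => b n * F n := hT.summable_mul_measure_partialSum_le hα hb ht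
  have hsum_succ : Summable fun n => b n * F (n + 1) :=
    hT.summable_mul_measure_partialSum_succ_le hα hb ht
  have hF_zero : F 0 = 1 := by simp [hF, partialSum_zero, ht]
  calc countMean μ T b t = ∑' n, (b n * F n - b n * F (n + 1)) :=
        tsum_congr fun n => by rw [hT.measureReal_countEvent hα, mul_sub]
    _ = b 0 + (∑' n, b (n + 1) * F (n + 1) - ∑' n, b n * F (n + 1)) := by
        rw [hsum.tsum_sub hsum_succ, hsum.tsum_eq_zero_add, hF_zero, mul_one, add_sub_assoc]
    _ = b 0 + ∑' n, fwdDiff 1 b n * F (n + 1) := by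
        rw [← ((summable_nat_add_iff 1).2 hsum).tsum_sub hsum_succ]
        simp only [fwdDiff, sub_mul]

lemma IsMittagLefflerRenewal.integral_rlKernel_mul_countMean (ht : 0 ≤ t) :
    ∫ u in Ioo 0 t, rlKernel α (t - u) * countMean μ T b u =
      ∑' n, b n * μ.real {ω | partialSum T (n + 1) ω ≤ t} := by
  have hint (n : ℕ) :
      IntegrableOn (fun u => rlKernel α (t - u) * μ.real (countEvent T n u)) (Ioo 0 t) := by
    rcases ht.eq_or_lt with rfl | ht
    · simp
    exact integrableOn_rlKernel_mul_of_bounded hα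
      (measurable_measureReal_countEvent hT.measurable n) ht fun u _ =>
        (abs_of_nonneg measureReal_nonneg).trans_le measureReal_le_one
  have hnorm (n : ℕ) : ∫ u in Ioo 0 t, ‖b n * (rlKernel α (t - u) * μ.real (countEvent T n u))‖ =
      |b n| * μ.real {ω | partialSum T (n + 1) ω ≤ t} := by
    rw [hT.measureReal_partialSum_succ_le hα, ← integral_const_mul]
    exact setIntegral_congr_fun measurableSet_Ioo fun u hu => by
      simp only [norm_mul, Real.norm_eq_abs, abs_of_nonneg measureReal_nonneg,
        abs_of_nonneg (rlKernel_nonneg hα (sub_nonneg.2 hu.2.le))]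
  have hsum : Summable fun n =>
      ∫ u in Ioo 0 t, ‖b n * (rlKernel α (t - u) * μ.real (countEvent T n u))‖ :=
    (hT.summable_mul_measure_partialSum_succ_le hα hb.abs ht).congr fun n => (hnorm n).symm
  calc ∫ u in Ioo 0 t, rlKernel α (t - u) * countMean μ T b u
      = ∫ u in Ioo 0 t, ∑' n, b n * (rlKernel α (t - u) * μ.real (countEvent T n u)) := by
        simp only [countMean, ← tsum_mul_left, mul_left_comm]
    _ = ∑' n, b n * μ.real {ω | partialSum T (n + 1) ω ≤ t} := by
        rw [← integral_tsum_of_summable_integral_norm (fun n => (hint n).const_mul (b n)) hsum]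
        simp only [integral_const_mul, hT.measureReal_partialSum_succ_le hα]

/-- One more renewal costs one convolution with the kernel, so that the fractional integral of
`E Δb(N(u))` telescopes. -/
lemma IsMittagLefflerRenewal.countMean_eq_add_integral (ht : 0 ≤ t) :
    countMean μ T b t =
      b 0 + ∫ u in Ioo 0 t, rlKernel α (t - u) * countMean μ T (fwdDiff 1 b) u := by
  have hΔ : ExpBounded (fwdDiff 1 b) := hb.iterate_fwdDiff 1
  rw [hT.countMean_eq_add_tsum_fwdDiff hα hb ht, hT.integral_rlKernel_mul_countMean hα hΔ ht]

omit hb in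
lemma IsMittagLefflerRenewal.abs_countMean_le {K C : ℝ} (hC : 0 ≤ C)
    (hbC : ∀ n, |b n| ≤ K * C ^ n) {t₀ : ℝ} (htt₀ : t ≤ t₀) (ht₀ : 0 ≤ t₀) :
    |countMean μ T b t| ≤ K * ∑' n, C ^ n * μ.real {ω | partialSum T n ω ≤ t₀} := by
  have hpow : ExpBounded (C ^ ·) := ⟨1, C, hC, fun n => by simp [abs_of_nonneg hC]⟩
  rw [← Real.norm_eq_abs]
  refine tsum_of_norm_bounded
    ((hT.summable_mul_measure_partialSum_le hα hpow ht₀).hasSum.mul_left K) fun n => ?_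
  rw [norm_mul, Real.norm_eq_abs, Real.norm_of_nonneg measureReal_nonneg, ← mul_assoc]
  exact mul_le_mul (hbC n) (measureReal_countEvent_le n htt₀) measureReal_nonneg
    ((abs_nonneg _).trans (hbC n))

lemma IsMittagLefflerRenewal.countMean_eq_fracSeries (ht : 0 ≤ t) :
    countMean μ T b t = fracSeries α 1 (fun m => (fwdDiff 1)^[m] b 0) t := by
  obtain ⟨K, C, hC, hbC⟩ := id hb
  refine eq_fracSeries_of_eq_add_integral (f := fun m => countMean μ T ((fwdDiff 1)^[m] b))
    (K := K * ∑' n, C ^ n * μ.real {ω | partialSum T n ω ≤ t}) (D := C + 1) hα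
    (fun m => measurable_countMean hT.measurable _) (fun m u _ hut => ?_)
    (fun m u hu _ => ?_) hb.iterate_fwdDiff_zero (by positivity) ht
  · exact (hT.abs_countMean_le hα hC (abs_iterate_fwdDiff_le hbC m) hut ht).trans_eq
      (mul_right_comm _ _ _)
  · simpa only [Function.iterate_succ_apply'] using
      hT.countMean_eq_add_integral hα (hb.iterate_fwdDiff m) hu

theorem IsMittagLefflerRenewal.hasCaputoDerivAt_countMean (hα1 : α ≤ 1) {f : ℝ → ℝ}
    (hf : ∀ t, 0 ≤ t → f t = countMean μ T b t) (ht : 0 < t) :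
    HasCaputoDerivAt α f (countMean μ T (fwdDiff 1 b) t) t := by
  have hΔ : ExpBounded (fwdDiff 1 b) := hb.iterate_fwdDiff 1
  rw [hT.countMean_eq_fracSeries hα hΔ ht.le]
  exact hb.iterate_fwdDiff_zero.hasCaputoDerivAt_fracSeries hα hα1
    (fun t ht => (hf t ht).trans (hT.countMean_eq_fracSeries hα hb ht)) ht

end CountMean

/-! ### The queue in discrete time -/

section Chain

variable {Ω : Type*} [MeasurableSpace Ω] {μ : Measure Ω}

lemma measure_preimage_inter_eq_mul {β : Type*} [MeasurableSpace β] [MeasurableSingletonClass β]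
    [Countable β] {X : Ω → β} (hX : Measurable X) {s : Set β} {B : Set Ω} {c : ENNReal}
    (h : ∀ y ∈ s, μ (X ⁻¹' {y} ∩ B) = μ (X ⁻¹' {y}) * c) :
    μ (X ⁻¹' s ∩ B) = μ (X ⁻¹' s) * c := by
  have hmeas : ∀ y ∈ s, MeasurableSet (X ⁻¹' {y}) := fun y _ => hX (measurableSet_singleton y)
  rw [← Measure.restrict_apply (hX s.to_countable.measurableSet),
    ← tsum_measure_preimage_singleton s.to_countable hmeas,
    ← tsum_measure_preimage_singleton s.to_countable hmeas, ← ENNReal.tsum_mul_right]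
  refine tsum_congr fun y => ?_
  rw [Measure.restrict_apply (hmeas y y.2), h y y.2]

lemma measure_eq_tsum_preimage_inter {β : Type*} [MeasurableSpace β] [MeasurableSingletonClass β]
    [Countable β] {X : Ω → β} (hX : Measurable X) (A : Set Ω) :
    μ A = ∑' y, μ (X ⁻¹' {y} ∩ A) := by
  have h := tsum_measure_preimage_singleton (μ := μ.restrict A) (countable_univ (α := β))
    fun y _ => hX (measurableSet_singleton y)
  rw [tsum_univ fun y => μ.restrict A (X ⁻¹' {y}), preimage_univ, Measure.restrict_apply_univ] at h
  rw [← h]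
  exact tsum_congr fun y => Measure.restrict_apply (hX (measurableSet_singleton y))

lemma lintegral_comp_eq_tsum {β : Type*} [MeasurableSpace β] [MeasurableSingletonClass β]
    [Countable β] {X : Ω → β} (hX : Measurable X) (φ : β → ENNReal) :
    ∫⁻ ω, φ (X ω) ∂μ = ∑' y, μ (X ⁻¹' {y}) * φ y := by
  rw [← lintegral_map (measurable_of_countable φ) hX, lintegral_countable']
  refine tsum_congr fun y => ?_
  rw [Measure.map_apply hX (measurableSet_singleton y), mul_comm]

lemma integral_indicator_one_comp {β : Type*} [MeasurableSpace β] {X : Ω → β}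
    (hX : AEMeasurable X μ) {A : Set β} (hA : MeasurableSet A) :
    ∫ ω, A.indicator (1 : β → ℝ) (X ω) ∂μ = μ.real (X ⁻¹' A) := by
  rw [← integral_map hX (stronglyMeasurable_one.indicator hA).aestronglyMeasurable,
    integral_indicator_one hA, map_measureReal_apply_of_aemeasurable hX hA]

variable {p : ℝ}

lemma ofReal_queueTransition (p : ℝ) (i j : ℕ) :
    ENNReal.ofReal (queueTransition p i j) =
      ENNReal.ofReal p * ({i + 1} : Set ℕ).indicator 1 j +
        ENNReal.ofReal (1 - p) * ({i - 1} : Set ℕ).indicator 1 j := by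
  rw [queueTransition]
  split_ifs with h1 h2
  · simp [h1]
  · simp [h2]
  · simp [h1, h2]

variable {Q : ℕ → Ω → ℕ} (hQ : IsDiscreteQueue p Q μ)
include hQ

/-- The Markov property is summed over all paths ending in `i`. -/
lemma IsDiscreteQueue.measure_eq_and_succ_eq [IsFiniteMeasure μ] (n i j : ℕ) :
    μ {ω | Q n ω = i ∧ Q (n + 1) ω = j} =
      μ {ω | Q n ω = i} * ENNReal.ofReal (queueTransition p i j) := by
  let X : Ω → Fin (n + 1) → ℕ := fun ω k => Q k ω
  have hX : Measurable X := measurable_pi_lambda _ fun k => hQ.measurable k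
  refine measure_preimage_inter_eq_mul (s := {y | y (Fin.last n) = i}) hX fun y hy => ?_
  obtain ⟨x, hxy, hxj⟩ : ∃ x : ℕ → ℕ, (∀ k : Fin (n + 1), x k = y k) ∧ x (n + 1) = j :=
    ⟨Function.extend Fin.val y fun _ => j, fun k => Fin.val_injective.extend_apply _ _ _,
      Function.extend_apply' _ _ _ fun ⟨k, hk⟩ => k.2.ne hk⟩
  have hpath : {ω | ∀ k ≤ n, Q k ω = x k} = X ⁻¹' {y} := by
    ext ω
    simp only [mem_ofPred_eq, mem_preimage, mem_singleton_iff, funext_iff, X, ← hxy,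
      Fin.forall_iff, Nat.lt_succ_iff]
  have hpath_succ : {ω | ∀ k ≤ n + 1, Q k ω = x k} = X ⁻¹' {y} ∩ {ω | Q (n + 1) ω = j} := by
    ext ω
    simp only [← hpath, Nat.le_succ_iff, or_imp, forall_and, forall_eq, hxj, mem_ofPred_eq,
      mem_inter_iff]
  have hxi : x n = i := (hxy (Fin.last n)).trans hy
  have hmarkov := congrArg ENNReal.ofReal (hQ.markov n x)
  rwa [hpath, hpath_succ, hxi, hxj, ENNReal.ofReal_mul measureReal_nonneg, ofReal_measureReal,
    ofReal_measureReal] at hmarkov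

theorem IsDiscreteQueue.map_succ [IsFiniteMeasure μ] (n : ℕ) :
    μ.map (Q (n + 1)) = ENNReal.ofReal p • μ.map (fun ω => Q n ω + 1) +
      ENNReal.ofReal (1 - p) • μ.map (fun ω => Q n ω - 1) := by
  have hmeas (f : ℕ → ℕ) : Measurable fun ω => f (Q n ω) :=
    (measurable_of_countable f).comp (hQ.measurable n)
  refine Measure.ext_of_singleton fun j => ?_
  have hstep (f : ℕ → ℕ) : μ.map (fun ω => f (Q n ω)) {j} =
      ∑' i, μ (Q n ⁻¹' {i}) * ({f i} : Set ℕ).indicator 1 j := by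
    rw [← lintegral_comp_eq_tsum (hQ.measurable n) fun i => ({f i} : Set ℕ).indicator 1 j,
      Measure.map_apply (hmeas f) (measurableSet_singleton j),
      ← lintegral_indicator_one (hmeas f (measurableSet_singleton j))]
    exact lintegral_congr fun ω => by
      classical
      simp only [indicator_apply, mem_preimage, mem_singleton_iff, eq_comm (a := j), Pi.one_apply]
  rw [Measure.map_apply (hQ.measurable _) (measurableSet_singleton j),
    measure_eq_tsum_preimage_inter (hQ.measurable n), Measure.add_apply, Measure.smul_apply,
    Measure.smul_apply, hstep (· + 1), hstep (· - 1), smul_eq_mul, smul_eq_mul,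
    ← ENNReal.tsum_mul_left, ← ENNReal.tsum_mul_left, ← ENNReal.tsum_add]
  refine tsum_congr fun i => (hQ.measure_eq_and_succ_eq n i j).trans ?_
  rw [ofReal_queueTransition, mul_add, mul_left_comm, mul_left_comm (μ _)]
  rfl

lemma IsDiscreteQueue.ae_le [IsFiniteMeasure μ] (n : ℕ) : ∀ᵐ ω ∂μ, Q n ω ≤ n := by
  induction n with
  | zero => exact hQ.initial.mono fun ω hω => hω.le
  | succ n ih =>
    have hmeas (f : ℕ → ℕ) : Measurable fun ω => f (Q n ω) :=
      (measurable_of_countable f).comp (hQ.measurable n)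
    have hset : MeasurableSet {k | k ≤ n + 1} := .of_discrete
    rw [← ae_map_iff (hQ.measurable (n + 1)).aemeasurable hset, hQ.map_succ, ae_add_measure_iff]
    refine ⟨Measure.ae_smul_measure ?_ _, Measure.ae_smul_measure ?_ _⟩
    · rw [ae_map_iff (hmeas (· + 1)).aemeasurable hset]
      exact ih.mono fun ω hω => Nat.succ_le_succ hω
    · rw [ae_map_iff (hmeas (· - 1)).aemeasurable hset]
      exact ih.mono fun ω hω => by omega

lemma IsDiscreteQueue.integrable_comp [IsFiniteMeasure μ] (φ : ℕ → ℝ) (n : ℕ) :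
    Integrable (fun ω => φ (Q n ω)) μ := by
  refine .of_bound ((measurable_of_countable φ).comp (hQ.measurable n)).aestronglyMeasurable
    (∑ k ∈ Finset.range (n + 1), ‖φ k‖) ((hQ.ae_le n).mono fun ω hω => ?_)
  exact Finset.single_le_sum (f := fun k => ‖φ k‖) (fun _ _ => norm_nonneg _)
    (Finset.mem_range.2 (Nat.lt_succ_of_le hω))

theorem IsDiscreteQueue.integral_comp_succ [IsFiniteMeasure μ] (hp : 0 ≤ p) (hp1 : p ≤ 1) (n : ℕ)
    (φ : ℕ → ℝ) :
    ∫ ω, φ (Q (n + 1) ω) ∂μ = p * ∫ ω, φ (Q n ω + 1) ∂μ + (1 - p) * ∫ ω, φ (Q n ω - 1) ∂μ := by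
  have hmeas (f : ℕ → ℕ) : AEMeasurable (fun ω => f (Q n ω)) μ :=
    ((measurable_of_countable f).comp (hQ.measurable n)).aemeasurable
  have hφ {ν : Measure ℕ} : AEStronglyMeasurable φ ν :=
    (measurable_of_countable φ).aestronglyMeasurable
  have hint (f : ℕ → ℕ) : Integrable φ (μ.map fun ω => f (Q n ω)) :=
    (integrable_map_measure hφ (hmeas f)).2 (hQ.integrable_comp (fun k => φ (f k)) n)
  rw [← integral_map (hQ.measurable (n + 1)).aemeasurable hφ, hQ.map_succ,
    integral_add_measure ((hint (· + 1)).smul_measure ENNReal.ofReal_ne_top)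
      ((hint (· - 1)).smul_measure ENNReal.ofReal_ne_top), integral_smul_measure,
    integral_smul_measure, ENNReal.toReal_ofReal hp, ENNReal.toReal_ofReal (sub_nonneg.2 hp1),
    integral_map (hmeas (· + 1)) hφ, integral_map (hmeas (· - 1)) hφ, smul_eq_mul, smul_eq_mul]

lemma IsDiscreteQueue.expBounded_integral_pow [IsProbabilityMeasure μ] {y : ℝ} (hy : 0 ≤ y) :
    ExpBounded fun n => ∫ ω, y ^ Q n ω ∂μ := by
  refine ⟨1, max 1 y, le_max_of_le_left zero_le_one, fun n => ?_⟩
  have hbound : ∀ᵐ ω ∂μ, ‖y ^ Q n ω‖ ≤ max 1 y ^ n := (hQ.ae_le n).mono fun ω hω => by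
    rw [norm_pow, Real.norm_of_nonneg hy]
    exact (pow_le_pow_left₀ hy (le_max_right 1 y) _).trans
      (pow_le_pow_right₀ (le_max_left 1 y) hω)
  simpa using norm_integral_le_of_norm_le_const hbound

lemma IsDiscreteQueue.fwdDiff_integral_pow [IsFiniteMeasure μ] (hp : 0 ≤ p) (hp1 : p ≤ 1)
    {y : ℝ} (hy : y ≠ 0) (n : ℕ) :
    fwdDiff 1 (fun n => ∫ ω, y ^ Q n ω ∂μ) n =
      (1 - p) * (1 - y⁻¹) * μ.real (Q n ⁻¹' {0}) +
        (p * y - 1 + (1 - p) * y⁻¹) * ∫ ω, y ^ Q n ω ∂μ := by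
  have hpred (k : ℕ) :
      y ^ (k - 1) = y⁻¹ * y ^ k + (1 - y⁻¹) * ({0} : Set ℕ).indicator (1 : ℕ → ℝ) k := by
    rcases k with _ | k
    · simp
    · simp [pow_succ', hy]
  have hind := hQ.integrable_comp (({0} : Set ℕ).indicator 1) n
  rw [fwdDiff, hQ.integral_comp_succ hp hp1 n (y ^ ·)]
  simp only [pow_succ', hpred]
  rw [integral_add ((hQ.integrable_comp (y ^ ·) n).const_mul _) (hind.const_mul _),
    integral_const_mul, integral_const_mul, integral_const_mul,
    integral_indicator_one_comp (hQ.measurable n).aemeasurable (measurableSet_singleton 0)]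
  ring

lemma IsDiscreteQueue.measureReal_preimage_succ [IsFiniteMeasure μ] (hp : 0 ≤ p) (hp1 : p ≤ 1)
    (n : ℕ) (A : Set ℕ) :
    μ.real (Q (n + 1) ⁻¹' A) =
      p * μ.real (Q n ⁻¹' ((· + 1) ⁻¹' A)) + (1 - p) * μ.real (Q n ⁻¹' ((· - 1) ⁻¹' A)) := by
  have hmeas (f : ℕ → ℕ) : Measurable fun ω => f (Q n ω) :=
    (measurable_of_countable f).comp (hQ.measurable n)
  have hind {X : Ω → ℕ} (hX : Measurable X) :
      ∫ ω, A.indicator (1 : ℕ → ℝ) (X ω) ∂μ = μ.real (X ⁻¹' A) :=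
    integral_indicator_one_comp hX.aemeasurable .of_discrete
  have h := hQ.integral_comp_succ hp hp1 n (A.indicator 1)
  rwa [hind (hQ.measurable _), hind (hmeas (· + 1)), hind (hmeas (· - 1))] at h

end Chain

/-! ### The queue length -/

section QueueLength

variable {Ω : Type*} [MeasurableSpace Ω] {μ : Measure Ω} {α p : ℝ} {T : ℕ → Ω → ℝ} {Q : ℕ → Ω → ℕ}

lemma measurable_indicator_countEvent_mul (hT : ∀ n, Measurable (T n))
    (hQ : ∀ n, Measurable (Q n)) (t : ℝ) (φ : ℕ → ENNReal) (n : ℕ) :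
    Measurable fun ω => (countEvent T n t).indicator 1 ω * φ (Q n ω) :=
  (measurable_one.indicator (measurableSet_countEvent hT n t)).mul
    ((measurable_of_countable φ).comp (hQ n))

lemma lintegral_indicator_countEvent_mul (hT : ∀ n, Measurable (T n)) (hQ : ∀ n, Measurable (Q n))
    (hQT : IndepFun (fun ω n => Q n ω) (fun ω n => T n ω) μ) (t : ℝ) (φ : ℕ → ENNReal) (n : ℕ) :
    ∫⁻ ω, (countEvent T n t).indicator 1 ω * φ (Q n ω) ∂μ =
      μ (countEvent T n t) * ∫⁻ ω, φ (Q n ω) ∂μ := by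
  have hindep : IndepFun ((countEvent T n t).indicator 1) (fun ω => φ (Q n ω)) μ :=
    hQT.symm.comp (ψ := fun f : ℕ → ℕ => φ (f n))
      (φ := (countEvent (fun n (f : ℕ → ℝ) => f n) n t).indicator (1 : (ℕ → ℝ) → ENNReal))
      (measurable_one.indicator (measurableSet_countEvent measurable_pi_apply n t))
      ((measurable_of_countable φ).comp (measurable_pi_apply n))
  have hmeas := measurableSet_countEvent hT n t
  rw [← lintegral_indicator_one hmeas]
  exact lintegral_mul_eq_lintegral_mul_lintegral_of_indepFun (measurable_one.indicator hmeas)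
    ((measurable_of_countable φ).comp (hQ n)) hindep

variable [IsProbabilityMeasure μ] (hT : IsMittagLefflerRenewal α T μ) (hα : 0 < α)
include hT hα

lemma IsMittagLefflerRenewal.ae_comp_queueLength_eq_tsum {t : ℝ} (ht : 0 ≤ t) (φ : ℕ → ENNReal) :
    ∀ᵐ ω ∂μ, φ (queueLength Q T t ω) =
      ∑' n, (countEvent T n t).indicator 1 ω * φ (Q n ω) := by
  filter_upwards [hT.ae_mem_countEvent_iff hα ht] with ω hω
  rw [tsum_eq_single (countingProcess T t ω) fun n hn => by simp [hω, hn], queueLength]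
  simp [hω]

lemma IsMittagLefflerRenewal.aemeasurable_queueLength (hQ : ∀ n, Measurable (Q n)) {t : ℝ}
    (ht : 0 ≤ t) : AEMeasurable (queueLength Q T t) μ := by
  have hcast : MeasurableEmbedding ((↑) : ℕ → ENNReal) :=
    (measurable_of_countable _).measurableEmbedding Nat.cast_injective
  exact hcast.aemeasurable_comp_iff.1 ⟨_, Measurable.tsum fun n =>
    measurable_indicator_countEvent_mul hT.measurable hQ t (↑) n,
    hT.ae_comp_queueLength_eq_tsum hα ht (↑)⟩

theorem IsMittagLefflerRenewal.lintegral_comp_queueLength (hQ : ∀ n, Measurable (Q n))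
    (hQT : IndepFun (fun ω n => Q n ω) (fun ω n => T n ω) μ) {t : ℝ} (ht : 0 ≤ t)
    (φ : ℕ → ENNReal) :
    ∫⁻ ω, φ (queueLength Q T t ω) ∂μ = ∑' n, μ (countEvent T n t) * ∫⁻ ω, φ (Q n ω) ∂μ := by
  rw [lintegral_congr_ae (hT.ae_comp_queueLength_eq_tsum hα ht φ), lintegral_tsum fun n =>
    (measurable_indicator_countEvent_mul hT.measurable hQ t φ n).aemeasurable]
  exact tsum_congr fun n => lintegral_indicator_countEvent_mul hT.measurable hQ hQT t φ n

variable (hQ : IsDiscreteQueue p Q μ) (hQT : IndepFun (fun ω n => Q n ω) (fun ω n => T n ω) μ)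
  {φ : ℕ → ℝ} (hφ : ∀ k, 0 ≤ φ k) (hb : ExpBounded fun n => ∫ ω, φ (Q n ω) ∂μ) {t : ℝ} (ht : 0 ≤ t)
include hQ hQT hφ hb ht

lemma lintegral_ofReal_comp_queueLength :
    ∫⁻ ω, ENNReal.ofReal (φ (queueLength Q T t ω)) ∂μ =
      ENNReal.ofReal (countMean μ T (fun n => ∫ ω, φ (Q n ω) ∂μ) t) := by
  have hmean_nonneg (n : ℕ) : 0 ≤ ∫ ω, φ (Q n ω) ∂μ := integral_nonneg fun ω => hφ _
  rw [hT.lintegral_comp_queueLength hα hQ.measurable hQT ht (fun k => ENNReal.ofReal (φ k)),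
    countMean, ENNReal.ofReal_tsum_of_nonneg
      (fun n => mul_nonneg (hmean_nonneg n) measureReal_nonneg)
      (hT.summable_mul_measure_countEvent hα hb ht)]
  refine tsum_congr fun n => ?_
  rw [ENNReal.ofReal_mul (hmean_nonneg n), ofReal_measureReal, mul_comm,
    ofReal_integral_eq_lintegral_ofReal (hQ.integrable_comp φ n) (ae_of_all _ fun ω => hφ _)]

lemma integrable_comp_queueLength : Integrable (fun ω => φ (queueLength Q T t ω)) μ := by
  refine ⟨((measurable_of_countable φ).comp_aemeasurable
    (hT.aemeasurable_queueLength hα hQ.measurable ht)).aestronglyMeasurable, ?_⟩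
  rw [hasFiniteIntegral_iff_ofReal (ae_of_all _ fun ω => hφ _),
    lintegral_ofReal_comp_queueLength hT hα hQ hQT hφ hb ht]
  exact ENNReal.ofReal_lt_top

theorem integral_comp_queueLength :
    ∫ ω, φ (queueLength Q T t ω) ∂μ = countMean μ T (fun n => ∫ ω, φ (Q n ω) ∂μ) t := by
  rw [integral_eq_lintegral_of_nonneg_ae (ae_of_all _ fun ω => hφ _)
    (integrable_comp_queueLength hT hα hQ hQT hφ hb ht).aestronglyMeasurable,
    lintegral_ofReal_comp_queueLength hT hα hQ hQT hφ hb ht, ENNReal.toReal_ofReal]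
  exact tsum_nonneg fun n => mul_nonneg (integral_nonneg fun ω => hφ _) measureReal_nonneg

end QueueLength

section QueueMgf

variable {Ω : Type*} [MeasurableSpace Ω] {μ : Measure Ω} {α p : ℝ} {T : ℕ → Ω → ℝ} {Q : ℕ → Ω → ℕ}

lemma exp_mul_natCast (z : ℝ) (n : ℕ) : Real.exp (z * n) = Real.exp z ^ n := by
  rw [mul_comm, Real.exp_nat_mul]

lemma queueMgf_eq_integral_pow (z t : ℝ) :
    queueMgf μ Q T z t = ∫ ω, Real.exp z ^ queueLength Q T t ω ∂μ := by
  simp only [queueMgf, mgf, exp_mul_natCast]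

variable [IsProbabilityMeasure μ] (hT : IsMittagLefflerRenewal α T μ) (hα : 0 < α)
  (hQ : IsDiscreteQueue p Q μ) (hQT : IndepFun (fun ω n => Q n ω) (fun ω n => T n ω) μ) {t : ℝ}
include hT hα hQ hQT

lemma integrable_exp_mul_queueLength (z : ℝ) (ht : 0 ≤ t) :
    Integrable (fun ω => Real.exp (z * queueLength Q T t ω)) μ := by
  simp only [exp_mul_natCast]
  exact integrable_comp_queueLength hT hα hQ hQT (fun k => by positivity)
    (hQ.expBounded_integral_pow (Real.exp_nonneg z)) ht

lemma queueMgf_eq_countMean (z : ℝ) (ht : 0 ≤ t) :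
    queueMgf μ Q T z t = countMean μ T (fun n => ∫ ω, Real.exp z ^ Q n ω ∂μ) t := by
  rw [queueMgf_eq_integral_pow]
  exact integral_comp_queueLength hT hα hQ hQT (fun k => by positivity)
    (hQ.expBounded_integral_pow (Real.exp_nonneg z)) ht

omit hT hα hQ hQT in
lemma expBounded_measureReal_preimage (A : Set ℕ) : ExpBounded fun n => μ.real (Q n ⁻¹' A) :=
  ⟨1, 1, zero_le_one, fun n => by simp [abs_of_nonneg]⟩

lemma emptyProb_eq_countMean (ht : 0 ≤ t) :
    emptyProb μ Q T t = countMean μ T (fun n => μ.real (Q n ⁻¹' {0})) t := by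
  have hset : MeasurableSet ({0} : Set ℕ) := measurableSet_singleton 0
  have hmean (n : ℕ) := integral_indicator_one_comp (hQ.measurable n).aemeasurable hset (μ := μ)
  have hb := expBounded_measureReal_preimage (μ := μ) (Q := Q) {0}
  simp only [← hmean] at hb ⊢
  have hL := hT.aemeasurable_queueLength hα hQ.measurable ht
  exact (integral_indicator_one_comp hL hset).symm.trans
    (integral_comp_queueLength hT hα hQ hQT (indicator_nonneg fun _ _ => zero_le_one) hb ht)

theorem hasCaputoDerivAt_queueMgf (hα1 : α ≤ 1) (hp : 0 ≤ p) (hp1 : p ≤ 1) (z : ℝ) (ht : 0 < t) :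
    HasCaputoDerivAt α (queueMgf μ Q T z)
      ((1 - p) * (1 - Real.exp (-z)) * emptyProb μ Q T t +
        (p * Real.exp z - 1 + (1 - p) * Real.exp (-z)) * queueMgf μ Q T z t) t := by
  have hb := hQ.expBounded_integral_pow (Real.exp_nonneg z)
  have hderiv := hT.hasCaputoDerivAt_countMean hα hb hα1
    (fun t ht => queueMgf_eq_countMean hT hα hQ hQT z ht) ht
  have hempty := hT.summable_mul_measure_countEvent hα
    (expBounded_measureReal_preimage (μ := μ) (Q := Q) {0}) ht.le
  have hmgf := hT.summable_mul_measure_countEvent hα hb ht.le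
  convert hderiv using 1
  rw [emptyProb_eq_countMean hT hα hQ hQT ht.le, queueMgf_eq_countMean hT hα hQ hQT z ht.le,
    countMean, countMean, countMean, ← tsum_mul_left, ← tsum_mul_left,
    ← (hempty.mul_left _).tsum_add (hmgf.mul_left _)]
  refine tsum_congr fun n => ?_
  rw [hQ.fwdDiff_integral_pow hp hp1 (Real.exp_ne_zero z), Real.exp_neg]
  ring

end QueueMgf

/-! ### The characteristic roots -/

section Roots

variable {α p s : ℝ}

lemma one_lt_one_add_rpow (α : ℝ) (hs : 0 < s) : 1 < 1 + s ^ α :=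
  lt_add_of_pos_right _ (Real.rpow_pos_of_pos hs α)

lemma discriminant_pos (hs : 0 < s) : 0 < (1 + s ^ α) ^ 2 - 4 * p * (1 - p) := by
  nlinarith [one_lt_one_add_rpow α hs, sq_nonneg (2 * p - 1)]

lemma mul_r₁_add_r₂ (hp : p ≠ 0) : p * (r₁ α p s + r₂ α p s) = 1 + s ^ α := by
  rw [r₁, r₂]
  field

lemma mul_r₁_mul_r₂ (hp : p ≠ 0) (hs : 0 < s) : p * (r₁ α p s * r₂ α p s) = 1 - p := by
  have hsq := Real.sq_sqrt (discriminant_pos (α := α) (p := p) hs).le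
  rw [r₁, r₂, div_mul_div_comm, ← sq_sub_sq, hsq]
  field

lemma abs_lt_sqrt_discriminant (hp : 0 < p) (hs : 0 < s) :
    |2 * p - (1 + s ^ α)| < √((1 + s ^ α) ^ 2 - 4 * p * (1 - p)) := by
  rw [Real.lt_sqrt (abs_nonneg _), sq_abs]
  nlinarith [mul_pos hp (Real.rpow_pos_of_pos hs α)]

lemma one_lt_r₁ (hp : 0 < p) (hs : 0 < s) : 1 < r₁ α p s := by
  have h := (abs_lt.1 (abs_lt_sqrt_discriminant (α := α) hp hs)).2
  rw [r₁, lt_div_iff₀ (by positivity)]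
  linarith

lemma r₂_lt_one (hp : 0 < p) (hs : 0 < s) : r₂ α p s < 1 := by
  have h := (abs_lt.1 (abs_lt_sqrt_discriminant (α := α) hp hs)).1
  rw [r₂, div_lt_iff₀ (by positivity)]
  linarith

lemma r₂_nonneg (hp : 0 < p) (hp1 : p ≤ 1) (hs : 0 < s) : 0 ≤ r₂ α p s := by
  have hr : 0 < r₁ α p s := one_pos.trans (one_lt_r₁ hp hs)
  have hprod := mul_r₁_mul_r₂ (α := α) hp.ne' hs
  rw [← mul_assoc] at hprod
  exact nonneg_of_mul_nonneg_right (hprod.symm ▸ sub_nonneg.2 hp1) (mul_pos hp hr)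

end Roots

/-! ### The discounted occupation measure -/

/-- The hypothesis on `h` says that `h k - ρ * h (k + 1)` would grow like `σ⁻ᵏ` if it did not
vanish. -/
lemma eq_mul_succ_of_bounded {h : ℕ → ℝ} {B ρ σ : ℝ} (hB : ∀ k, |h k| ≤ B) (hσ : 0 ≤ σ)
    (hσ1 : σ < 1) (hrec : ∀ k, h k - ρ * h (k + 1) = σ * (h (k + 1) - ρ * h (k + 2))) (k : ℕ) :
    h k = ρ * h (k + 1) := by
  have hiter (j : ℕ) : h k - ρ * h (k + 1) = σ ^ j * (h (k + j) - ρ * h (k + j + 1)) := by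
    induction j with
    | zero => simp
    | succ j ih => rw [ih, hrec (k + j), pow_succ, mul_assoc]; rfl
  have hbound (j : ℕ) : |h k - ρ * h (k + 1)| ≤ σ ^ j * (B + |ρ| * B) := by
    rw [hiter j, abs_mul, abs_of_nonneg (pow_nonneg hσ j)]
    refine mul_le_mul_of_nonneg_left ((abs_sub _ _).trans (add_le_add (hB _) ?_)) (by positivity)
    rw [abs_mul]
    exact mul_le_mul_of_nonneg_left (hB _) (abs_nonneg ρ)
  have hlim : Tendsto (fun j : ℕ => σ ^ j * (B + |ρ| * B)) atTop (𝓝 0) := by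
    simpa only [zero_mul] using
      (tendsto_pow_atTop_nhds_zero_of_lt_one hσ hσ1).mul_const (B + |ρ| * B)
  exact sub_eq_zero.1 (abs_nonpos_iff.1 (ge_of_tendsto' hlim hbound))

section Occupation

variable {Ω : Type*} [MeasurableSpace Ω] {μ : Measure Ω} {α p s : ℝ} {Q : ℕ → Ω → ℕ} {x : ℝ}

/-- The mass `∑ xⁿ P(Q n = k)` which the occupation measure of `Q`, discounted by the factor `x` per
step, gives to `k`. -/
def occupation (μ : Measure Ω) (Q : ℕ → Ω → ℕ) (x : ℝ) (k : ℕ) : ℝ :=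
  ∑' n, x ^ n * μ.real (Q n ⁻¹' {k})

variable [IsProbabilityMeasure μ]

lemma summable_occupation (hx : 0 ≤ x) (hx1 : x < 1) (k : ℕ) :
    Summable fun n => x ^ n * μ.real (Q n ⁻¹' {k}) :=
  .of_nonneg_of_le (fun n => by positivity)
    (fun n => mul_le_of_le_one_right (by positivity) measureReal_le_one)
    (summable_geometric_of_lt_one hx hx1)

lemma abs_occupation_le (hx : 0 ≤ x) (hx1 : x < 1) (k : ℕ) :
    |occupation μ Q x k| ≤ (1 - x)⁻¹ := by
  rw [occupation, abs_of_nonneg (tsum_nonneg fun n => by positivity),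
    ← tsum_geometric_of_lt_one hx hx1]
  exact (summable_occupation hx hx1 k).tsum_le_tsum
    (fun n => mul_le_of_le_one_right (by positivity) measureReal_le_one)
    (summable_geometric_of_lt_one hx hx1)

lemma tsum_ofReal_pow_mul_lintegral_comp (hQ : ∀ n, Measurable (Q n)) (hx : 0 ≤ x) (hx1 : x < 1)
    (φ : ℕ → ENNReal) :
    ∑' n, ENNReal.ofReal (x ^ n) * ∫⁻ ω, φ (Q n ω) ∂μ =
      ∑' k, ENNReal.ofReal (occupation μ Q x k) * φ k := by
  simp only [fun n => lintegral_comp_eq_tsum (μ := μ) (hQ n) φ, ← ENNReal.tsum_mul_left]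
  rw [ENNReal.tsum_comm]
  refine tsum_congr fun k => ?_
  rw [occupation, ENNReal.ofReal_tsum_of_nonneg (fun n => by positivity)
    (summable_occupation hx hx1 k), ← ENNReal.tsum_mul_right]
  refine tsum_congr fun n => ?_
  rw [ENNReal.ofReal_mul (by positivity), ofReal_measureReal, mul_assoc]

variable (hQ : IsDiscreteQueue p Q μ)
include hQ

lemma IsDiscreteQueue.measureReal_initial (k : ℕ) :
    μ.real (Q 0 ⁻¹' {k}) = if k = 0 then 1 else 0 := by
  have hae : (Q 0 ⁻¹' {k} : Set Ω) =ᵐ[μ] {_ω | k = 0} := hQ.initial.mono fun ω hω =>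
    propext (show Q 0 ω = k ↔ k = 0 by rw [hω, eq_comm])
  rw [measureReal_congr hae]
  split_ifs with hk <;> simp [hk]

variable (hp1 : p ≤ 1)
include hp1

lemma IsDiscreteQueue.occupation_succ (hp : 0 ≤ p) (hx : 0 ≤ x) (hx1 : x < 1) (k : ℕ) :
    occupation μ Q x (k + 1) =
      x * (p * occupation μ Q x k + (1 - p) * occupation μ Q x (k + 2)) := by
  have hsum := summable_occupation (μ := μ) (Q := Q) hx hx1
  rw [occupation, (hsum (k + 1)).tsum_eq_zero_add, hQ.measureReal_initial, if_neg k.succ_ne_zero,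
    mul_zero, zero_add]
  refine ((((hsum k).hasSum.mul_left p).add ((hsum (k + 2)).hasSum.mul_left (1 - p))).mul_left
    x).congr_fun (fun n => ?_) |>.tsum_eq
  have hup : (· + 1) ⁻¹' {k + 1} = ({k} : Set ℕ) := by ext; simp
  have hdown : (· - 1) ⁻¹' {k + 1} = ({k + 2} : Set ℕ) := by ext i; simp
  rw [hQ.measureReal_preimage_succ hp hp1, hup, hdown]
  ring

lemma IsDiscreteQueue.occupation_zero (hp : 0 ≤ p) (hx : 0 ≤ x) (hx1 : x < 1) :
    occupation μ Q x 0 =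
      1 + x * ((1 - p) * (occupation μ Q x 0 + occupation μ Q x 1)) := by
  have hsum := summable_occupation (μ := μ) (Q := Q) hx hx1
  nth_rw 1 [occupation]
  rw [(hsum 0).tsum_eq_zero_add, hQ.measureReal_initial, if_pos rfl, pow_zero, mul_one]
  congr 1
  refine ((((hsum 0).hasSum.add (hsum 1).hasSum).mul_left (1 - p)).mul_left x).congr_fun
    (fun n => ?_) |>.tsum_eq
  have hup : (· + 1) ⁻¹' {0} = (∅ : Set ℕ) := by ext; simp
  have hdown : (· - 1) ⁻¹' {0} = ({0} ∪ {1} : Set ℕ) := by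
    ext i
    simp only [mem_preimage, mem_union, mem_singleton_iff]
    omega
  rw [hQ.measureReal_preimage_succ hp hp1, hup, hdown, preimage_union, measureReal_union
    (Disjoint.preimage _ (by simp)) (hQ.measurable n (measurableSet_singleton 1)), preimage_empty,
    measureReal_empty]
  ring

variable (hp : 0 < p) (hs : 0 < s)
include hp hs

lemma IsDiscreteQueue.occupation_eq_r₁_mul_succ (k : ℕ) :
    occupation μ Q (1 + s ^ α)⁻¹ k = r₁ α p s * occupation μ Q (1 + s ^ α)⁻¹ (k + 1) := by
  have hpos : 1 < 1 + s ^ α := one_lt_one_add_rpow α hs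
  have hx : 0 ≤ (1 + s ^ α)⁻¹ := by positivity
  have hx1 : (1 + s ^ α)⁻¹ < 1 := inv_lt_one_of_one_lt₀ hpos
  refine eq_mul_succ_of_bounded (abs_occupation_le hx hx1) (r₂_nonneg (α := α) hp hp1 hs)
    (r₂_lt_one hp hs) (fun k => mul_left_cancel₀ hp.ne' ?_) k
  have hsucc := hQ.occupation_succ hp1 hp.le hx hx1 k
  rw [eq_inv_mul_iff_mul_eq₀ (by positivity)] at hsucc
  linear_combination -hsucc - occupation μ Q (1 + s ^ α)⁻¹ (k + 1) * mul_r₁_add_r₂ hp.ne' +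
    occupation μ Q (1 + s ^ α)⁻¹ (k + 2) * mul_r₁_mul_r₂ (α := α) hp.ne' hs

lemma IsDiscreteQueue.occupation_zero_eq :
    occupation μ Q (1 + s ^ α)⁻¹ 0 = (1 + s ^ α) / (p * r₁ α p s * (1 - r₂ α p s)) := by
  have hpos : 1 < 1 + s ^ α := one_lt_one_add_rpow α hs
  have hr₁ : 0 < r₁ α p s := one_pos.trans (one_lt_r₁ hp hs)
  have hr₂ : 0 < 1 - r₂ α p s := sub_pos.2 (r₂_lt_one hp hs)
  have hzero := hQ.occupation_zero hp1 hp.le (x := (1 + s ^ α)⁻¹) (by positivity)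
    (inv_lt_one_of_one_lt₀ hpos)
  rw [← sub_eq_iff_eq_add', eq_inv_mul_iff_mul_eq₀ (by positivity)] at hzero
  rw [eq_div_iff (by positivity)]
  linear_combination hzero + occupation μ Q (1 + s ^ α)⁻¹ 0 * mul_r₁_add_r₂ hp.ne' -
    (occupation μ Q (1 + s ^ α)⁻¹ 0 + occupation μ Q (1 + s ^ α)⁻¹ 1) *
      mul_r₁_mul_r₂ (α := α) hp.ne' hs -
    p * r₂ α p s * hQ.occupation_eq_r₁_mul_succ (α := α) hp1 hp hs 0

theorem IsDiscreteQueue.occupation_eq (k : ℕ) :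
    occupation μ Q (1 + s ^ α)⁻¹ k =
      (1 + s ^ α) / (p * r₁ α p s * (1 - r₂ α p s)) * (r₁ α p s)⁻¹ ^ k := by
  have hr₁ : r₁ α p s ≠ 0 := (one_pos.trans (one_lt_r₁ hp hs)).ne'
  induction k with
  | zero => rw [hQ.occupation_zero_eq hp1 hp hs, pow_zero, mul_one]
  | succ k ih =>
    rw [pow_succ, ← mul_assoc, ← ih, hQ.occupation_eq_r₁_mul_succ hp1 hp hs k]
    field

end Occupation

/-! ### The Laplace transform of the moment generating function -/

section LaplaceReal

variable {f : ℝ → ℝ} {s : ℝ}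

lemma laplaceConvergent_iff_laplaceLIntegral_lt_top (hf : AEMeasurable f (volume.restrict (Ioi 0)))
    (hf0 : ∀ t, 0 ≤ f t) :
    LaplaceConvergent f s ↔ laplaceLIntegral (fun t => ENNReal.ofReal (f t)) s < ⊤ := by
  have hmeas : AEStronglyMeasurable (fun t => Real.exp (-s * t) * f t) (volume.restrict (Ioi 0)) :=
    (AEMeasurable.mul (by fun_prop) hf).aestronglyMeasurable
  rw [LaplaceConvergent, IntegrableOn, Integrable, and_iff_right hmeas,
    hasFiniteIntegral_iff_ofReal (ae_of_all _ fun t => mul_nonneg (Real.exp_nonneg _) (hf0 t)),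
    laplaceLIntegral]
  simp only [ENNReal.ofReal_mul (Real.exp_nonneg _)]

lemma laplaceTransform_eq_toReal_laplaceLIntegral (hf : AEMeasurable f (volume.restrict (Ioi 0)))
    (hf0 : ∀ t, 0 ≤ f t) :
    laplaceTransform f s = (laplaceLIntegral (fun t => ENNReal.ofReal (f t)) s).toReal := by
  rw [laplaceTransform, integral_eq_lintegral_of_nonneg_ae
    (ae_of_all _ fun t => mul_nonneg (Real.exp_nonneg _) (hf0 t))
    (AEMeasurable.mul (by fun_prop) hf).aestronglyMeasurable, laplaceLIntegral]
  simp only [ENNReal.ofReal_mul (Real.exp_nonneg _)]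

lemma laplaceLIntegral_tsum_mul_const {F : ℕ → ℝ → ENNReal} (hF : ∀ n, Measurable (F n))
    (c : ℕ → ENNReal) (s : ℝ) :
    laplaceLIntegral (fun t => ∑' n, F n t * c n) s = ∑' n, laplaceLIntegral (F n) s * c n := by
  have hmeas (n : ℕ) : Measurable fun t => ENNReal.ofReal (Real.exp (-s * t)) * F n t := by
    fun_prop
  simp only [laplaceLIntegral, ← ENNReal.tsum_mul_left, ← mul_assoc]
  rw [lintegral_tsum fun n => ((hmeas n).mul_const (c n)).aemeasurable]
  exact tsum_congr fun n => lintegral_mul_const (c n) (hmeas n)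

end LaplaceReal

section Transform

variable {Ω : Type*} [MeasurableSpace Ω] {μ : Measure Ω} [IsProbabilityMeasure μ] {α p : ℝ}
  {T : ℕ → Ω → ℝ} {Q : ℕ → Ω → ℕ} (hT : IsMittagLefflerRenewal α T μ) (hα : 0 < α)
  (hQ : IsDiscreteQueue p Q μ) (hQT : IndepFun (fun ω n => Q n ω) (fun ω n => T n ω) μ)
include hT hα hQ hQT

lemma aemeasurable_queueMgf (z : ℝ) :
    AEMeasurable (queueMgf μ Q T z) (volume.restrict (Ioi 0)) :=
  (measurable_countMean hT.measurable _).aemeasurable.congr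
    ((ae_restrict_iff' measurableSet_Ioi).2 (ae_of_all _ fun _ ht =>
      (queueMgf_eq_countMean hT hα hQ hQT z (le_of_lt ht)).symm))

lemma ofReal_queueMgf (z : ℝ) {t : ℝ} (ht : 0 ≤ t) :
    ENNReal.ofReal (queueMgf μ Q T z t) =
      ∑' n, μ (countEvent T n t) * ∫⁻ ω, ENNReal.ofReal (Real.exp z ^ Q n ω) ∂μ := by
  rw [queueMgf, mgf, ofReal_integral_eq_lintegral_ofReal
    (integrable_exp_mul_queueLength hT hα hQ hQT z ht) (ae_of_all _ fun ω => Real.exp_nonneg _)]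
  simp only [exp_mul_natCast]
  exact hT.lintegral_comp_queueLength hα hQ.measurable hQT ht
    fun k => ENNReal.ofReal (Real.exp z ^ k)

variable (z : ℝ) {s : ℝ} (hs : 0 < s)
include hs

theorem laplaceLIntegral_queueMgf_eq_tsum_occupation :
    laplaceLIntegral (fun t => ENNReal.ofReal (queueMgf μ Q T z t)) s =
      ENNReal.ofReal (s ^ (α - 1) / (1 + s ^ α)) * ∑' k,
        ENNReal.ofReal (occupation μ Q (1 + s ^ α)⁻¹ k) * ENNReal.ofReal (Real.exp z ^ k) := by
  have hpos : 1 < 1 + s ^ α := one_lt_one_add_rpow α hs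
  have hdiv (n : ℕ) : s ^ (α - 1) / (1 + s ^ α) ^ (n + 1) =
      s ^ (α - 1) / (1 + s ^ α) * (1 + s ^ α)⁻¹ ^ n := by
    rw [pow_succ', div_mul_eq_div_div, inv_pow, div_eq_mul_inv (s ^ (α - 1) / (1 + s ^ α))]
  rw [laplaceLIntegral_congr fun t ht => ofReal_queueMgf hT hα hQ hQT z ht.le,
    laplaceLIntegral_tsum_mul_const fun n => measurable_measure_countEvent hT.measurable n,
    ← tsum_ofReal_pow_mul_lintegral_comp hQ.measurable (by positivity)
      (inv_lt_one_of_one_lt₀ hpos) fun k => ENNReal.ofReal (Real.exp z ^ k),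
    ← ENNReal.tsum_mul_left]
  refine tsum_congr fun n => ?_
  rw [hT.laplaceLIntegral_countEvent hα hs, hdiv, ENNReal.ofReal_mul (by positivity), mul_assoc]

variable (hp : 0 < p) (hp1 : p ≤ 1)
include hp hp1

theorem laplaceLIntegral_queueMgf :
    laplaceLIntegral (fun t => ENNReal.ofReal (queueMgf μ Q T z t)) s =
      ENNReal.ofReal (s ^ (α - 1) / (p * r₁ α p s * (1 - r₂ α p s))) *
        (1 - ENNReal.ofReal (Real.exp z / r₁ α p s))⁻¹ := by
  have hr₁ : 0 < r₁ α p s := one_pos.trans (one_lt_r₁ hp hs)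
  have hr₂ : 0 < 1 - r₂ α p s := sub_pos.2 (r₂_lt_one hp hs)
  rw [laplaceLIntegral_queueMgf_eq_tsum_occupation hT hα hQ hQT z hs,
    ← ENNReal.tsum_geometric, ← ENNReal.tsum_mul_left, ← ENNReal.tsum_mul_left]
  refine tsum_congr fun k => ?_
  rw [hQ.occupation_eq hp1 hp hs, ← ENNReal.ofReal_mul (by positivity),
    ← ENNReal.ofReal_mul (by positivity), ← ENNReal.ofReal_pow (by positivity),
    ← ENNReal.ofReal_mul (by positivity), div_pow, inv_pow]
  congr 1
  field

theorem laplaceConvergent_queueMgf_iff :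
    LaplaceConvergent (queueMgf μ Q T z) s ↔ Real.exp z < r₁ α p s := by
  have hr₁ : 0 < r₁ α p s := one_pos.trans (one_lt_r₁ hp hs)
  have hr₂ : 0 < 1 - r₂ α p s := sub_pos.2 (r₂_lt_one hp hs)
  rw [laplaceConvergent_iff_laplaceLIntegral_lt_top (aemeasurable_queueMgf hT hα hQ hQT z)
    (fun _ => mgf_nonneg), laplaceLIntegral_queueMgf hT hα hQ hQT z hs hp hp1,
    ENNReal.mul_lt_top_iff]
  have hc : ENNReal.ofReal (s ^ (α - 1) / (p * r₁ α p s * (1 - r₂ α p s))) ≠ 0 :=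
    (ENNReal.ofReal_pos.2 (by positivity)).ne'
  simp only [ENNReal.ofReal_lt_top, true_and, hc, ENNReal.inv_eq_zero, ENNReal.inv_lt_top,
    tsub_pos_iff_lt, ENNReal.ofReal_lt_one, div_lt_one hr₁, false_or]
  simp

variable {z} in
theorem laplaceTransform_queueMgf (hz : Real.exp z < r₁ α p s) :
    laplaceTransform (queueMgf μ Q T z) s =
      -s ^ (α - 1) / (p * (Real.exp z - r₁ α p s) * (1 - r₂ α p s)) := by
  have hr₁ : 0 < r₁ α p s := one_pos.trans (one_lt_r₁ hp hs)
  have hr₂ : 0 < 1 - r₂ α p s := sub_pos.2 (r₂_lt_one hp hs)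
  have hratio : 0 < 1 - Real.exp z / r₁ α p s := sub_pos.2 ((div_lt_one hr₁).2 hz)
  have hz' : 0 < r₁ α p s - Real.exp z := sub_pos.2 hz
  rw [laplaceTransform_eq_toReal_laplaceLIntegral (aemeasurable_queueMgf hT hα hQ hQT z)
    (fun _ => mgf_nonneg), laplaceLIntegral_queueMgf hT hα hQ hQT z hs hp hp1,
    ← ENNReal.ofReal_one, ← ENNReal.ofReal_sub _ (by positivity), ENNReal.toReal_mul,
    ENNReal.toReal_inv, ENNReal.toReal_ofReal (by positivity), ENNReal.toReal_ofReal hratio.le]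
  rw [one_sub_div hr₁.ne', ← neg_sub (r₁ α p s) (Real.exp z)]
  field

end Transform

end FractionalQueue

end

theorem mainTheorem1 {Ω : Type*} [MeasurableSpace Ω] (μ : Measure Ω) [IsProbabilityMeasure μ]
    (α p : ℝ) (hα : 0 < α) (hα1 : α ≤ 1) (hp : 0 < p) (hp1 : p ≤ 1)
    (Q : ℕ → Ω → ℕ) (T : ℕ → Ω → ℝ)
    (hQ : FractionalQueue.IsDiscreteQueue p Q μ)
    (hT : FractionalQueue.IsMittagLefflerRenewal α T μ)
    (hQT : IndepFun (fun ω n => Q n ω) (fun ω n => T n ω) μ)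
    (z : ℝ) :
    (∀ t : ℝ, 0 ≤ t →
      Integrable (fun ω => Real.exp (z * (FractionalQueue.queueLength Q T t ω : ℝ))) μ) ∧
    (∀ t : ℝ, 0 < t →
      FractionalQueue.HasCaputoDerivAt α (FractionalQueue.queueMgf μ Q T z)
        ((1 - p) * (1 - Real.exp (-z)) * FractionalQueue.emptyProb μ Q T t +
          (p * Real.exp z - 1 + (1 - p) * Real.exp (-z)) * FractionalQueue.queueMgf μ Q T z t)
        t) ∧
    (∀ s : ℝ, 0 < s →
      (FractionalQueue.LaplaceConvergent (FractionalQueue.queueMgf μ Q T z) s ↔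
        Real.exp z < FractionalQueue.r₁ α p s) ∧
      (Real.exp z < FractionalQueue.r₁ α p s →
        FractionalQueue.laplaceTransform (FractionalQueue.queueMgf μ Q T z) s =
          -s ^ (α - 1) /
            (p * (Real.exp z - FractionalQueue.r₁ α p s) * (1 - FractionalQueue.r₂ α p s)))) :=
  ⟨fun _ ht => FractionalQueue.integrable_exp_mul_queueLength hT hα hQ hQT z ht,
    fun _ ht => FractionalQueue.hasCaputoDerivAt_queueMgf hT hα hQ hQT hα1 hp.le hp1 z ht,
    fun _ hs => ⟨FractionalQueue.laplaceConvergent_queueMgf_iff hT hα hQ hQT z hs hp hp1,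
      fun hz => FractionalQueue.laplaceTransform_queueMgf hT hα hQ hQT hs hp hp1 hz⟩⟩
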